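/- \textbf{Proposition (Generalized gyration).} Let $\Lambda$ be a finite region of the square lattice $\mathbb{Z}^2$ enclosed by a simple closed path of length $2N>0$ on the dual lattice, run counter-clockwise from a chosen starting point. The edges of $\Lambda$ are the lattice edges with at least one endpoint in the region. The $2N$ boundary edges (\emph{terminations}), i.e. the edges crossed by the path, are numbered $1,\dots,2N$ in the order in which the path crosses them. For $\tau\in\{b,w\}^{2N}$ let $\mathrm{Fpl}(\Lambda,\tau)$ be the set of colourings of the edges of $\Lambda$ in black and white such that every vertex of the region is adjacent to two black and two white edges and the $k$-th termination has colour $\tau_k$; let $\bar\tau$ be the complementary boundary condition. Let $\mathrm{LP}(m)$ be the set of non-crossing perfect matchings (link patterns) of $2m$ cyclically labelled points on the border of a disk. If $\tau$ has $2m$ black terminations, labelled $1,\dots,2m$ in the above order, every $\phi\in\mathrm{Fpl}(\Lambda,\tau)$ has a link pattern $\pi(\phi)\in\mathrm{LP}(m)$, pairing the labels that are connected by open black paths, and $\Psi_{\Lambda,\tau}(\pi)$ denotes the number of $\phi\in\mathrm{Fpl}(\Lambda,\tau)$ with $\pi(\phi)=\pi$. For $1\le j\le 2m-1$ let $c_j:\mathbb{C}^{\mathrm{LP}(m)}\to\mathbb{C}^{\mathrm{LP}(m-1)}$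 be the linear operator that joins the points $j$ and $j+1$ to each other and removes them (together with the cycle that arises if $j$ and $j+1$ were matched, with weight $1$), the other points being relabelled in order. Glue together the outer ends of the terminations $2i-1$ and $2i$ into one vertex of degree two, for every $1\le i\le N$, and call $\mathcal{G}$ the resulting graph. Let $\Gamma$ be the partition of its edges into the cycles formed by the edges of $\Lambda$ around the elementary plaquettes of the same parity as those lying between the terminations $2i-1$ and $2i$. Let $V''(\tau)$ be the set of the glued vertices with one black and one white termination. Assume that the triplet $(\mathcal{G},\tau,\Gamma)$ is valid: all the cycles in $\Gamma$ have length at most $4$, and all those adjacent to a vertex of $V''(\tau)$ have length at most $3$. Let $N_{bb},N_{ww},N_{bw},N_{wb}$ be the numbers of pairs $(2i-1,2i)$ with colours $(b,b)$, $(w,w)$, $(b,w)$, $(w,b)$ in $\tau$, and suppose that $N_{bw}+N_{wb}=2n$ is even (otherwise $\mathrm{Fpl}(\Lambda,\tau)$ and $\mathrm{Fpl}(\Lambda,\bar\tau)$ are empty). Put $m_1=n+N_{bb}$ and $m_2=n+N_{ww}$, so that $\tau$ and $\bar\tau$ have $2m_1$ and $2m_2$ black terminations respectively, and let $$|s_1\rangle=\sum_{\pi\in\mathrm{LP}(m_1)}\Psi_{\Lambda,\tau}(\pi)\,|\pi\rangle,\qquad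 |s_2\rangle=\sum_{\pi\in\mathrm{LP}(m_2)}\Psi_{\Lambda,\bar\tau}(\pi)\,|\pi\rangle .$$ Let $J_1\subset\{1,\dots,2m_1-1\}$ be the set of the labels, among the black terminations of $\tau$, of the first termination of each pair coloured $(b,b)$ in $\tau$, and let $J_2\subset\{1,\dots,2m_2-1\}$ be the analogous set for $\bar\tau$ (that is, for the pairs coloured $(w,w)$ in $\tau$). Then, in $\mathbb{C}^{\mathrm{LP}(n)}$, $$\Big(\prod_{j\in J_1}c_j\Big)|s_1\rangle=\Big(\prod_{j\in J_2}c_j\Big)|s_2\rangle ,$$ where both products are written in increasing order of $j$ from left to right (the factor with the highest index acts first). -/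

import Mathlib

/-! ### Link patterns and the closing operators

Points are labelled from `0`: the `2 n` points on the border of the disk are
`0, 1, …, 2 n - 1`, in cyclic order. -/

/-- A link pattern in `LP(n)`: a non-crossing perfect matching of `2 n` points on the border of a
disk, given by the fixed-point-free involution that sends every point to its partner. -/
@[ext]
structure LinkPattern (n : ℕ) where
  partner : Fin (2 * n) → Fin (2 * n)
  partner_partner : ∀ i, partner (partner i) = i
  partner_ne : ∀ i, partner i ≠ i
  noncrossing : ∀ i k, ¬ (i < k ∧ k < partner i ∧ partner i < partner k)

namespace LinkPattern

noncomputable instance (n : ℕ) : Fintype (LinkPattern n) :=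
  Fintype.ofInjective LinkPattern.partner fun _ _ h => LinkPattern.ext h

/-- The increasing relabelling of the points other than `j`, `j + 1`. -/
def skip {n : ℕ} (j : ℕ) (i : Fin (2 * n)) : Fin (2 * (n + 1)) :=
  if i.val < j then ⟨i.val, by omega⟩ else ⟨i.val + 2, by omega⟩

/-- The partner of a point `x` (other than `a`, `b`) once the points `a` and `b` have been joined
to each other by an external arc. -/
def joined {n : ℕ} (π : LinkPattern n) (a b x : Fin (2 * n)) : Fin (2 * n) :=
  if π.partner x = a then π.partner b
  else if π.partner x = b then π.partner a
  else π.partner x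

theorem skip_ne {n j : ℕ} (i : Fin (2 * n)) :
    (skip j i).val ≠ j ∧ (skip j i).val ≠ j + 1 := by
  unfold skip; split <;> simp <;> omega

theorem exists_skip {n j : ℕ} (h : j + 1 < 2 * (n + 1)) (x : Fin (2 * (n + 1)))
    (h0 : x.val ≠ j) (h1 : x.val ≠ j + 1) : ∃ i : Fin (2 * n), skip j i = x := by
  rcases Nat.lt_or_ge x.val j with hx | hx
  · exact ⟨⟨x.val, by omega⟩, by simp [skip, hx]⟩
  · refine ⟨⟨x.val - 2, by omega⟩, ?_⟩
    have : ¬ (x.val - 2 < j) := by omega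
    ext; simp [skip, this]; omega

theorem skip_lt_iff {n j : ℕ} (i k : Fin (2 * n)) : skip j i < skip j k ↔ i < k := by
  simp only [skip, Fin.lt_def]; split <;> split <;> simp <;> omega

theorem skip_injective {n j : ℕ} : Function.Injective (skip (n := n) j) := by
  intro i k h
  rcases lt_trichotomy i k with h1 | h1 | h1
  · exact absurd h ((skip_lt_iff (j := j) i k).2 h1).ne
  · exact h1
  · exact absurd h ((skip_lt_iff (j := j) k i).2 h1).ne'

theorem joined_ne {n : ℕ} (π : LinkPattern n) {a b x : Fin (2 * n)}
    (hxa : x ≠ a) (hxb : x ≠ b) : π.joined a b x ≠ a ∧ π.joined a b x ≠ b := by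
  have hx := π.partner_partner x
  have ha := π.partner_partner a
  have hb := π.partner_partner b
  have na := π.partner_ne a
  have nb := π.partner_ne b
  unfold joined
  split_ifs <;> constructor <;> intro h <;> simp_all

theorem joined_joined {n : ℕ} (π : LinkPattern n) {a b x : Fin (2 * n)}
    (hxa : x ≠ a) (hxb : x ≠ b) : π.joined a b (π.joined a b x) = x := by
  have hx := π.partner_partner x
  have ha := π.partner_partner a
  have hb := π.partner_partner b
  unfold joined
  split_ifs <;> simp_all

theorem joined_self_ne {n : ℕ} (π : LinkPattern n) {a b x : Fin (2 * n)} (hab : a ≠ b) :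
    π.joined a b x ≠ x := by
  have hx := π.partner_partner x
  have ha := π.partner_partner a
  have hb := π.partner_partner b
  have nx := π.partner_ne x
  unfold joined
  split_ifs <;> intro h <;> simp_all

theorem joined_noncrossing {n : ℕ} (π : LinkPattern n) {a b x y : Fin (2 * n)}
    (hab : b.val = a.val + 1) (hxa : x ≠ a) (hxb : x ≠ b) (hya : y ≠ a) (hyb : y ≠ b) :
    ¬ (x < y ∧ y < π.joined a b x ∧ π.joined a b x < π.joined a b y) := by
  have hx := π.partner_partner x
  have hy := π.partner_partner y
  have ha := π.partner_partner a
  have hb := π.partner_partner b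
  have nc := π.noncrossing
  simp only [Fin.lt_def] at nc ⊢
  simp only [ne_eq, Fin.ext_iff] at hxa hxb hya hyb
  unfold joined
  split_ifs with h1 h2 h3 h4 h5 h6
  all_goals
    have a1 := nc x y
    have a2 := nc x a
    have a3 := nc x b
    have a4 := nc y a
    have a5 := nc y b
    have a6 := nc a y
    have a7 := nc b y
    have a8 := nc x (π.partner a)
    have a9 := nc x (π.partner b)
    have b1 := nc y (π.partner a)
    have b2 := nc y (π.partner b)
    have b3 := nc (π.partner a) y
    have b4 := nc (π.partner b) y
    have b5 := nc (π.partner a) x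
    have b6 := nc (π.partner b) x
    have b7 := nc a x
    have b8 := nc b x
    simp_all
  all_goals grind

/-- The arc-closing operation `c_j : LP(n+1) → LP(n)` on link patterns: the points `j` and `j + 1`
are joined to each other and removed (together with the cycle that arises if they were partners),
and the other points keep their order. -/
noncomputable def close {n : ℕ} (j : ℕ) (h : j + 1 < 2 * (n + 1)) (π : LinkPattern (n + 1)) :
    LinkPattern n :=
  let a : Fin (2 * (n + 1)) := ⟨j, by omega⟩
  let b : Fin (2 * (n + 1)) := ⟨j + 1, h⟩
  have hs : ∀ i : Fin (2 * n), skip j i ≠ a ∧ skip j i ≠ b := fun i => by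
    simpa [a, b, Fin.ext_iff] using skip_ne (j := j) i
  have hex : ∀ i : Fin (2 * n), ∃ k : Fin (2 * n), skip j k = π.joined a b (skip j i) := fun i => by
    have hj := π.joined_ne (hs i).1 (hs i).2
    refine exists_skip h _ ?_ ?_
    · simpa [a, Fin.ext_iff] using hj.1
    · simpa [b, Fin.ext_iff] using hj.2
  { partner := fun i => (hex i).choose
    partner_partner := fun i => skip_injective (j := j) (by
      rw [(hex _).choose_spec, (hex i).choose_spec]
      exact π.joined_joined (hs i).1 (hs i).2)
    partner_ne := fun i hi => by
      have h1 := (hex i).choose_spec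
      rw [hi] at h1
      exact π.joined_self_ne (by simp [a, b, Fin.ext_iff]) h1.symm
    noncrossing := fun i k hik => by
      rw [← skip_lt_iff (j := j) i, ← skip_lt_iff (j := j) k, ← skip_lt_iff (j := j) _ (hex k).choose,
        (hex i).choose_spec, (hex k).choose_spec] at hik
      exact π.joined_noncrossing rfl (hs i).1 (hs i).2 (hs k).1 (hs k).2 hik }

/-- The defining property of `close`. -/
theorem skip_close_partner {n : ℕ} (j : ℕ) (h : j + 1 < 2 * (n + 1)) (π : LinkPattern (n + 1))
    (i : Fin (2 * n)) :
    skip j ((close j h π).partner i) = π.joined ⟨j, by omega⟩ ⟨j + 1, h⟩ (skip j i) := by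
  unfold close
  exact Exists.choose_spec (p := fun k => skip j k = _) _

end LinkPattern

/-- The space `ℂ^{LP(n)}`; the basis vector `|π⟩` is `Finsupp.single π 1`. -/
abbrev LPSpace (n : ℕ) : Type := LinkPattern n →₀ ℂ

open Classical in
/-- The linear operator `c_j`, `c_j |π⟩ = |c_j π⟩`, defined for `j + 1 < 2 (n + 1)`
(and set to `0` for the other `j`, that are never used). -/
noncomputable def closeOp (n j : ℕ) : LPSpace (n + 1) →ₗ[ℂ] LPSpace n :=
  if h : j + 1 < 2 * (n + 1) then Finsupp.lmapDomain ℂ ℂ (LinkPattern.close j h) else 0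

/-- For a list `[j₁, j₂, …, j_r]` the operator `c_{j_r} ⋯ c_{j₂} c_{j₁}`: the head of the list acts
first. -/
noncomputable def closeList (n : ℕ) : (L : List ℕ) → (LPSpace (n + L.length) →ₗ[ℂ] LPSpace n)
  | [] => LinearMap.id
  | j :: L => (closeList n L).comp (closeOp (n + L.length) j)

/-- The product of the `c_j`, `j ∈ J`, written in increasing order from left to right: the highest
index acts first. -/
noncomputable def closeProd (n : ℕ) (J : Finset ℕ) :
    LPSpace (n + (J.sort (· ≥ ·)).length) →ₗ[ℂ] LPSpace n :=
  closeList n (J.sort (· ≥ ·))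

/-! ### Boundary conditions

A boundary condition on `2 N` terminations, listed in cyclic order from a fixed starting point, is a
map `τ : Fin (2 * N) → Bool`, where `true` stands for black and `false` for white. -/

/-- The complementary boundary condition. -/
def complBC {N : ℕ} (τ : Fin (2 * N) → Bool) : Fin (2 * N) → Bool := fun k => !τ k

/-- The first termination of the `i`-th pair of consecutive terminations. -/
def fstTerm {N : ℕ} (i : Fin N) : Fin (2 * N) := ⟨2 * i.val, by omega⟩

/-- The second termination of the `i`-th pair of consecutive terminations. -/
def sndTerm {N : ℕ} (i : Fin N) : Fin (2 * N) := ⟨2 * i.val + 1, by omega⟩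

/-- The black terminations. -/
def blackTerms {N : ℕ} (τ : Fin (2 * N) → Bool) : Finset (Fin (2 * N)) :=
  Finset.univ.filter fun k => τ k = true

/-- The pairs coloured (black, black). -/
def bbPairs {N : ℕ} (τ : Fin (2 * N) → Bool) : Finset (Fin N) :=
  Finset.univ.filter fun i => τ (fstTerm i) = true ∧ τ (sndTerm i) = true

/-- The pairs coloured (black, white) or (white, black). -/
def mixedPairs {N : ℕ} (τ : Fin (2 * N) → Bool) : Finset (Fin N) :=
  Finset.univ.filter fun i => τ (fstTerm i) ≠ τ (sndTerm i)

/-- The label of a black termination in the cyclic labelling of the black terminations. -/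
def blackLabel {N : ℕ} (τ : Fin (2 * N) → Bool) (k : Fin (2 * N)) : ℕ :=
  ((blackTerms τ).filter fun l => l < k).card

/-- The set of the labels, among the black terminations, of the first termination of each
(black, black) pair. -/
def bbIndices {N : ℕ} (τ : Fin (2 * N) → Bool) : Finset ℕ :=
  (bbPairs τ).image fun i => blackLabel τ (fstTerm i)

theorem blackLabel_lt {N : ℕ} (τ : Fin (2 * N) → Bool) {k l : Fin (2 * N)} (hk : τ k = true)
    (h : k < l) : blackLabel τ k < blackLabel τ l := by
  refine Finset.card_lt_card (Finset.ssubset_iff.2 ⟨k, by simp, ?_⟩)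
  intro x hx
  simp only [Finset.mem_insert, Finset.mem_filter, blackTerms, Finset.mem_univ, true_and] at hx ⊢
  rcases hx with rfl | hx
  · exact ⟨hk, h⟩
  · exact ⟨hx.1, hx.2.trans h⟩

theorem card_bbIndices {N : ℕ} (τ : Fin (2 * N) → Bool) :
    (bbIndices τ).card = (bbPairs τ).card := by
  refine Finset.card_image_of_injOn ?_
  intro i hi k hk h
  simp only [bbPairs, Finset.coe_filter, Finset.mem_univ, true_and, Set.mem_ofPred_eq] at hi hk
  rcases lt_trichotomy i k with h1 | h1 | h1
  · have := blackLabel_lt τ hi.1 (l := fstTerm k) (by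
      rw [Fin.lt_def] at h1 ⊢; simp only [fstTerm]; omega)
    simp_all
  · exact h1
  · have := blackLabel_lt τ hk.1 (l := fstTerm i) (by
      rw [Fin.lt_def] at h1 ⊢; simp only [fstTerm]; omega)
    simp_all

theorem card_blackTerms {N : ℕ} (τ : Fin (2 * N) → Bool) :
    (blackTerms τ).card = 2 * (bbPairs τ).card + (mixedPairs τ).card := by
  have hf : Function.Injective (fstTerm (N := N)) := fun i k h => by
    simp [fstTerm, Fin.ext_iff] at *; omega
  have hs : Function.Injective (sndTerm (N := N)) := fun i k h => by
    simp [sndTerm, Fin.ext_iff] at *; omega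
  have h1 : blackTerms τ =
      ((Finset.univ.filter fun i => τ (fstTerm i) = true).image fstTerm) ∪
      ((Finset.univ.filter fun i => τ (sndTerm i) = true).image sndTerm) := by
    ext k
    simp only [blackTerms, Finset.mem_filter, Finset.mem_univ, true_and, Finset.mem_union,
      Finset.mem_image]
    constructor
    · intro hk
      rcases Nat.even_or_odd' k.val with ⟨c, hc | hc⟩
      · have : fstTerm ⟨c, by omega⟩ = k := by simp [fstTerm, Fin.ext_iff, hc]
        exact Or.inl ⟨⟨c, by omega⟩, by rw [this]; exact hk, this⟩
      · have : sndTerm ⟨c, by omega⟩ = k := by simp [sndTerm, Fin.ext_iff, hc]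
        exact Or.inr ⟨⟨c, by omega⟩, by rw [this]; exact hk, this⟩
    · rintro (⟨i, hi, rfl⟩ | ⟨i, hi, rfl⟩) <;> exact hi
  have hd : Disjoint ((Finset.univ.filter fun i => τ (fstTerm i) = true).image (fstTerm (N := N)))
      ((Finset.univ.filter fun i => τ (sndTerm i) = true).image sndTerm) := by
    rw [Finset.disjoint_left]
    intro k hk hk'
    simp only [Finset.mem_image] at hk hk'
    obtain ⟨i, -, rfl⟩ := hk
    obtain ⟨l, -, h⟩ := hk'
    simp [fstTerm, sndTerm, Fin.ext_iff] at h
    omega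
  rw [h1, Finset.card_union_of_disjoint hd, Finset.card_image_of_injective _ hf,
    Finset.card_image_of_injective _ hs]
  simp only [bbPairs, mixedPairs, Finset.card_filter, Finset.mul_sum, ← Finset.sum_add_distrib]
  refine Finset.sum_congr rfl fun i _ => ?_
  cases τ (fstTerm i) <;> cases τ (sndTerm i) <;> simp

theorem mixedPairs_complBC {N : ℕ} (τ : Fin (2 * N) → Bool) :
    mixedPairs (complBC τ) = mixedPairs τ := by
  ext i; simp [mixedPairs, complBC]

/-- If there are `2 n` mixed pairs, then there are `2 m` black terminations, where `m` is the sum of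
`n` and of the number of (black, black) pairs. -/
theorem card_blackTerms_eq {N n : ℕ} (τ : Fin (2 * N) → Bool) (hn : (mixedPairs τ).card = 2 * n) :
    (blackTerms τ).card = 2 * (n + ((bbIndices τ).sort (· ≥ ·)).length) := by
  rw [card_blackTerms, Finset.length_sort, card_bbIndices, hn]; ring

/-! ### The square lattice -/

/-- The edges of the square lattice `ℤ × ℤ`: `horiz x y` joins `(x, y)` to `(x + 1, y)`, and
`vert x y` joins `(x, y)` to `(x, y + 1)`. -/
inductive LatticeEdge : Type
  | horiz (x y : ℤ)
  | vert (x y : ℤ)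
  deriving DecidableEq

namespace LatticeEdge

/-- The lower or left endpoint of an edge. -/
def src : LatticeEdge → ℤ × ℤ
  | horiz x y => (x, y)
  | vert x y => (x, y)

/-- The upper or right endpoint of an edge. -/
def tgt : LatticeEdge → ℤ × ℤ
  | horiz x y => (x + 1, y)
  | vert x y => (x, y + 1)

end LatticeEdge

/-- The four edges at a lattice vertex. -/
def edgesAt (v : ℤ × ℤ) : Finset LatticeEdge :=
  {.horiz v.1 v.2, .horiz (v.1 - 1) v.2, .vert v.1 v.2, .vert v.1 (v.2 - 1)}

/-- The four edges around the elementary plaquette with corners `(a, b)`, `(a + 1, b)`,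
`(a + 1, b + 1)`, `(a, b + 1)`. The plaquettes are identified with the vertices of the dual lattice:
`(a, b)` stands for the dual vertex at the point `(a + 1/2, b + 1/2)`. -/
def plaquetteEdges (p : ℤ × ℤ) : Finset LatticeEdge :=
  {.horiz p.1 p.2, .horiz p.1 (p.2 + 1), .vert p.1 p.2, .vert (p.1 + 1) p.2}

/-- The directions of the unit steps on the dual lattice. -/
inductive Dir : Type
  | east
  | north
  | west
  | south

namespace Dir

/-- The unit vector of a direction. -/
def vec : Dir → ℤ × ℤ
  | east => (1, 0)
  | north => (0, 1)
  | west => (-1, 0)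
  | south => (0, -1)

/-- The lattice edge crossed by the unit step in direction `d` from the dual vertex `p`. -/
def crossed (p : ℤ × ℤ) : Dir → LatticeEdge
  | east => .vert (p.1 + 1) p.2
  | north => .horiz p.1 (p.2 + 1)
  | west => .vert p.1 p.2
  | south => .horiz p.1 p.2

/-- The endpoint of the crossed edge that lies on the left of the step. -/
def left (p : ℤ × ℤ) : Dir → ℤ × ℤ
  | east => (p.1 + 1, p.2 + 1)
  | north => (p.1, p.2 + 1)
  | west => (p.1, p.2)
  | south => (p.1 + 1, p.2)

/-- The endpoint of the crossed edge that lies on the right of the step. -/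
def right (p : ℤ × ℤ) : Dir → ℤ × ℤ
  | east => (p.1 + 1, p.2)
  | north => (p.1 + 1, p.2 + 1)
  | west => (p.1, p.2 + 1)
  | south => (p.1, p.2)

theorem crossed_mem_edgesAt_left (p : ℤ × ℤ) (d : Dir) : d.crossed p ∈ edgesAt (d.left p) := by
  cases d <;> simp [crossed, left, edgesAt]

end Dir

/-! ### Domains, terminations and fully-packed loops -/

/-- A region `Λ` of the square lattice, bounded by a simple closed path of length `2 N` on the dual
lattice. The path is run counter-clockwise from a chosen starting point; it visits the dual vertices
`corner 0, corner 1, …`, the step from `corner k` to `corner (k + 1)` having direction `dir k`. The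
set `verts` of the vertices enclosed by the path is the finite set that is separated from
its complement exactly by the path: every step of the path has a vertex of the region on its left
and a vertex outside the region on its right, and every lattice edge with exactly one endpoint in
the region is crossed by the path. -/
structure LatticeDomain (N : ℕ) where
  pos : 0 < N
  corner : ZMod (2 * N) → ℤ × ℤ
  dir : ZMod (2 * N) → Dir
  corner_succ : ∀ k, corner (k + 1) = corner k + (dir k).vec
  corner_injective : Function.Injective corner
  verts : Finset (ℤ × ℤ)
  left_mem : ∀ k, (dir k).left (corner k) ∈ verts
  right_notMem : ∀ k, (dir k).right (corner k) ∉ verts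
  boundary_crossed : ∀ e : LatticeEdge, ¬ (e.src ∈ verts ↔ e.tgt ∈ verts) →
    ∃ k, (dir k).crossed (corner k) = e

namespace LatticeDomain

variable {N : ℕ} (Λ : LatticeDomain N)

/-- The edges of the domain (internal edges and boundary edges): the lattice edges with at least one
endpoint in the region. -/
abbrev Edge : Type := {e : LatticeEdge // e ∈ Λ.verts.biUnion edgesAt}

/-- The terminations of the domain, in cyclic order: the `k`-th one is the boundary edge crossed by
the `k`-th step of the boundary path (so that `corner (k + 1)` is the plaquette between the
terminations `k` and `k + 1`). -/
def term (k : Fin (2 * N)) : Λ.Edge :=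
  ⟨(Λ.dir (k.val : ZMod (2 * N))).crossed (Λ.corner (k.val : ZMod (2 * N))),
    Finset.mem_biUnion.2 ⟨_, Λ.left_mem _, Dir.crossed_mem_edgesAt_left _ _⟩⟩

/-- The fully-packed loop configurations: at every vertex of the region, two of the four edges are
black and two are white. -/
def IsFPL (φ : Λ.Edge → Bool) : Prop :=
  ∀ v ∈ Λ.verts, ∀ c : Bool,
    (Finset.univ.filter fun e : Λ.Edge => e.val ∈ edgesAt v ∧ φ e = c).card = 2

/-- The configurations in `Fpl(Λ; τ)`. -/
def IsFPLWith (τ : Fin (2 * N) → Bool) (φ : Λ.Edge → Bool) : Prop :=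
  Λ.IsFPL φ ∧ ∀ k, φ (Λ.term k) = τ k

/-- Two edges of the same colour meet at a vertex of the region. -/
def Consecutive (φ : Λ.Edge → Bool) (e f : Λ.Edge) : Prop :=
  φ e = φ f ∧ ∃ v ∈ Λ.verts, e.val ∈ edgesAt v ∧ f.val ∈ edgesAt v

/-- Two edges belong to the same monochromatic path (or cycle). -/
def SamePath (φ : Λ.Edge → Bool) : Λ.Edge → Λ.Edge → Prop :=
  Relation.ReflTransGen (Λ.Consecutive φ)

/-- `π` is the link pattern `π(φ)` of the configuration `φ` in `Fpl(Λ; τ)`: the black terminations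
being labelled in cyclic order, two distinct labels are partners in `π` if and only if a black open
path of `φ` has the two corresponding terminations as its ends. -/
def HasLinkPattern {m : ℕ} (τ : Fin (2 * N) → Bool) (h : (blackTerms τ).card = 2 * m)
    (φ : Λ.Edge → Bool) (π : LinkPattern m) : Prop :=
  ∀ i k : Fin (2 * m), π.partner i = k ↔
    i ≠ k ∧ Λ.SamePath φ (Λ.term ((blackTerms τ).orderEmbOfFin h i))
      (Λ.term ((blackTerms τ).orderEmbOfFin h k))

/-- The refined enumeration `Ψ_{Λ,τ}(π)`. -/
noncomputable def refinedCount {m : ℕ} (τ : Fin (2 * N) → Bool)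
    (h : (blackTerms τ).card = 2 * m) (π : LinkPattern m) : ℕ :=
  Nat.card {φ : Λ.Edge → Bool // Λ.IsFPLWith τ φ ∧ Λ.HasLinkPattern τ h φ π}

/-- The vector `∑ π, Ψ_{Λ,τ}(π) |π⟩` of `ℂ^{LP(m)}`, where `2 m` is the number of black
terminations. -/
noncomputable def state {m : ℕ} (τ : Fin (2 * N) → Bool) (h : (blackTerms τ).card = 2 * m) :
    LPSpace m :=
  ∑ π : LinkPattern m, (Λ.refinedCount τ h π : ℂ) • Finsupp.single π 1

/-! ### The glued graph and valid triplets -/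

/-- The vertices of the graph `G_+(Λ)` in which the terminations of each pair are glued: the (degree
four) vertices of the region, and one vertex of degree two for each pair. -/
abbrev GluedVertex : Type := {v : ℤ × ℤ // v ∈ Λ.verts} ⊕ Fin N

/-- Incidence of edges and vertices in the graph `G_+(Λ)`, whose edges are those of `Λ`. -/
def GluedIncident (e : Λ.Edge) : Λ.GluedVertex → Prop
  | .inl v => e.val ∈ edgesAt v.val
  | .inr i => e = Λ.term (fstTerm i) ∨ e = Λ.term (sndTerm i)

/-- The set `V''(τ)`: the vertices of degree two with one black and one white edge. -/
def mixedVertices (τ : Fin (2 * N) → Bool) : Set Λ.GluedVertex :=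
  {x | ∃ i : Fin N, x = .inr i ∧ τ (fstTerm i) ≠ τ (sndTerm i)}

/-- The edges of the domain around the plaquette `p`. -/
def cycleAt (p : ℤ × ℤ) : Finset Λ.Edge :=
  Finset.univ.filter fun e => e.val ∈ plaquetteEdges p

/-- The collection `Γ` of the cycles of `G_+(Λ)`, as sets of edges, given by the plaquettes of
the parity of those that lie between the two terminations of a pair. -/
def gyrationCycles : Set (Finset Λ.Edge) :=
  {γ | γ.Nonempty ∧ ∃ p : ℤ × ℤ,
    Even ((p.1 + p.2) - ((Λ.corner 1).1 + (Λ.corner 1).2)) ∧ γ = Λ.cycleAt p}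

/-- The triplet `(G_+(Λ), τ, Γ)` is valid: all cycles in `Γ` have length at most four, and those
adjacent to a vertex of `V''(τ)` have length at most three. -/
def ValidTriplet (τ : Fin (2 * N) → Bool) : Prop :=
  (∀ γ ∈ Λ.gyrationCycles, γ.card ≤ 4) ∧
  ∀ γ ∈ Λ.gyrationCycles, ∀ x ∈ Λ.mixedVertices τ,
    (∃ e ∈ γ, Λ.GluedIncident e x) → γ.card ≤ 3

end LatticeDomain

/-! The proof is a form of Wieland's gyration. Every edge of the domain lies in exactly one
plaquette of the chosen parity. Invert the colours around all these plaquettes, except the interior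
ones whose colours alternate. At a vertex the four edges form two pairs, one per plaquette, so the
two-and-two condition survives (`isFPL_gyrate`). Boundary edges are always flipped and alternation
is preserved, so `gyrate` is an involution exchanging the configurations of `τ` and of `complBC τ`
(`gyrateEquiv`).

Gyration need not preserve link patterns, but it preserves a coarser connectivity. Applying the
closing operators to the link pattern of `φ` glues the two terminations of every black pair. What
remains is a link pattern on the mixed pairs, representing the equivalence relation generated by the
black paths and the gluings (`exists_closeProd_single`). A link pattern is determined by the
relation it represents, so it suffices that two mixed pairs are connected for `φ` exactly when they
are for `gyrate φ`, with the black pairs of `complBC τ` now glued (`gluedPath_gyrate_iff`).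

The local fact behind this is `gluedPath_gyrate_of_plaq_eq`: the white edges of a non-alternating
plaquette become part of one glued black path. Validity is what excludes the bad case, a plaquette
with four edges of alternating colours whose corner outside the region is a mixed glued vertex. A
black path of `φ` can then be followed from plaquette to plaquette; the set `attached` is the
invariant that records the corresponding path of `gyrate φ`.

It must also be shown that configurations do have link patterns (`exists_represents`). Open paths
have two ends by an Euler characteristic count (`card_boundary_component`), and they do not cross by
an argument in cohomology modulo 2 on the dual lattice (`not_crossing`). -/

/-! ### Link patterns of equivalence relations -/

namespace LinkPattern

/-- The link pattern `π` describes which of the points `pos i` are equivalent. -/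
def Represents {X : Type*} {m : ℕ} (π : LinkPattern m) (pos : Fin (2 * m) → X) (S : Setoid X) :
    Prop :=
  ∀ i k, π.partner i = k ↔ i ≠ k ∧ S (pos i) (pos k)

theorem Represents.unique {X : Type*} {m : ℕ} {π ρ : LinkPattern m} {pos : Fin (2 * m) → X}
    {S : Setoid X} (h : π.Represents pos S) (h' : ρ.Represents pos S) : π = ρ := by
  ext1
  funext i
  exact (h i _).2 ((h' i _).1 rfl)

end LinkPattern

/-- The equivalence relation obtained by merging the classes of `a` and `b`. -/
def Setoid.merge {X : Type*} (S : Setoid X) (a b : X) : Setoid X where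
  r x y := S x y ∨ (S x a ∧ S b y) ∨ (S x b ∧ S a y)
  iseqv :=
    { refl := fun x => Or.inl (S.refl x)
      symm := fun {x y} h => by
        rcases h with h | ⟨h, h'⟩ | ⟨h, h'⟩
        · exact Or.inl (S.symm h)
        · exact Or.inr (Or.inr ⟨S.symm h', S.symm h⟩)
        · exact Or.inr (Or.inl ⟨S.symm h', S.symm h⟩)
      trans := fun {x y z} h k => by
        rcases h with h | ⟨h, h'⟩ | ⟨h, h'⟩ <;> rcases k with k | ⟨k, k'⟩ | ⟨k, k'⟩
        · exact Or.inl (S.trans h k)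
        · exact Or.inr (Or.inl ⟨S.trans h k, k'⟩)
        · exact Or.inr (Or.inr ⟨S.trans h k, k'⟩)
        · exact Or.inr (Or.inl ⟨h, S.trans h' k⟩)
        · exact Or.inr (Or.inl ⟨h, k'⟩)
        · exact Or.inl (S.trans h k')
        · exact Or.inr (Or.inr ⟨h, S.trans h' k⟩)
        · exact Or.inl (S.trans h k')
        · exact Or.inr (Or.inr ⟨h, k'⟩) }

theorem Setoid.merge_iff {X : Type*} (S : Setoid X) (a b x y : X) :
    S.merge a b x y ↔ S x y ∨ (S x a ∧ S b y) ∨ (S x b ∧ S a y) := Iff.rfl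

/-! ### Closing operators as merging of equivalence classes -/

namespace LinkPattern

/-- Away from `a` and `b`, merging their classes creates a new relation only between the partner of
`a` and the partner of `b`, which is the case split in `joined`. -/
theorem Represents.joined_eq_iff {X : Type*} {m : ℕ} {π : LinkPattern m} {pos : Fin (2 * m) → X}
    {S : Setoid X} (h : π.Represents pos S) {a b x y : Fin (2 * m)}
    (hxa : x ≠ a) (hxb : x ≠ b) (hya : y ≠ a) (hyb : y ≠ b) (hab : a ≠ b) :
    π.joined a b x = y ↔ x ≠ y ∧ S.merge (pos a) (pos b) (pos x) (pos y) := by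
  have e1 : ∀ u v, u ≠ v → (S (pos u) (pos v) ↔ π.partner u = v) := fun u v huv => by
    rw [h u v]; simp [huv]
  rw [Setoid.merge_iff, e1 x a hxa, e1 x b hxb, e1 a y hya.symm, e1 b y hyb.symm]
  have hpx := π.partner_partner x
  have hpa := π.partner_partner a
  have hpb := π.partner_partner b
  have hnx := π.joined_self_ne (x := x) hab
  by_cases hxy : x = y
  · subst hxy; simp [hnx]
  · rw [e1 x y hxy]
    unfold joined
    split_ifs <;> grind

/-- Each closing operator amounts to one `Setoid.merge`, so planar diagrams can be replaced by
computations with equivalence relations. -/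
theorem Represents.close {X : Type*} {m j : ℕ} {π : LinkPattern (m + 1)}
    {pos : Fin (2 * (m + 1)) → X} {S : Setoid X} (h : π.Represents pos S)
    (hj : j + 1 < 2 * (m + 1)) :
    (close j hj π).Represents (pos ∘ skip j)
      (S.merge (pos ⟨j, by omega⟩) (pos ⟨j + 1, hj⟩)) := by
  intro i k
  have hi := skip_ne (j := j) i
  have hk := skip_ne (j := j) k
  have key := h.joined_eq_iff (a := ⟨j, by omega⟩) (b := ⟨j + 1, hj⟩) (x := skip j i)
    (y := skip j k) (by simpa [Fin.ext_iff] using hi.1) (by simpa [Fin.ext_iff] using hi.2)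
    (by simpa [Fin.ext_iff] using hk.1) (by simpa [Fin.ext_iff] using hk.2) (by simp)
  rw [← skip_close_partner j hj π i, skip_injective.eq_iff, skip_injective.ne_iff] at key
  exact key

theorem skip_strictMono {n j : ℕ} : StrictMono (skip (n := n) j) :=
  fun i k h => (skip_lt_iff i k).2 h

theorem skip_val_of_lt {n j : ℕ} {i : Fin (2 * n)} (h : i.val < j) : (skip j i).val = i.val := by
  simp [skip, h]

theorem skip_val_of_le {n j : ℕ} {i : Fin (2 * n)} (h : j ≤ i.val) :
    (skip j i).val = i.val + 2 := by
  simp [skip, not_lt.2 h]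

end LinkPattern

theorem closeOp_single {n j : ℕ} (hj : j + 1 < 2 * (n + 1)) (π : LinkPattern (n + 1)) :
    closeOp n j (Finsupp.single π 1) = Finsupp.single (LinkPattern.close j hj π) 1 := by
  simp [closeOp, hj]

/-- Closing successively the disjoint arcs `(j, j + 1)`, `j ∈ L`, from right to left. -/
theorem exists_closeList_single {X : Type*} (n : ℕ) (L : List ℕ)
    (hL : L.Pairwise fun a b => b + 1 < a) (hb : ∀ j ∈ L, j + 1 < 2 * (n + L.length)) :
    ∃ s : Fin (2 * n) → Fin (2 * (n + L.length)), StrictMono s ∧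
      (∀ a, ∀ j ∈ L, (s a).val ≠ j ∧ (s a).val ≠ j + 1) ∧
      ∀ (π : LinkPattern (n + L.length)) (pos : Fin (2 * (n + L.length)) → X) (S : Setoid X),
        π.Represents pos S → ∃ (ρ : LinkPattern n) (S' : Setoid X),
          closeList n L (Finsupp.single π 1) = Finsupp.single ρ 1 ∧ ρ.Represents (pos ∘ s) S' ∧
          S ≤ S' ∧ (∀ a b, a.val ∈ L → b.val = a.val + 1 → S' (pos a) (pos b)) ∧
          ∀ T : Setoid X, S ≤ T → (∀ a b, a.val ∈ L → b.val = a.val + 1 → T (pos a) (pos b)) →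
            S' ≤ T := by
  induction L with
  | nil =>
    refine ⟨id, strictMono_id, by simp, fun π pos S h => ⟨π, S, rfl, h, le_rfl, by simp, ?_⟩⟩
    intro T h _
    exact h
  | cons j L ih =>
    rw [List.pairwise_cons] at hL
    have hlen : (j :: L).length = L.length + 1 := rfl
    have hj : j + 1 < 2 * ((n + L.length) + 1) := hb j (by simp)
    -- The remaining indices satisfy `j' + 1 < j`, so they stay in range when two points disappear.
    obtain ⟨s, hs, hne, H⟩ := ih hL.2 fun j' hj' => by have := hL.1 j' hj'; omega
    refine ⟨fun a => LinkPattern.skip j (s a), LinkPattern.skip_strictMono.comp hs, ?_, ?_⟩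
    · intro a j' hj'
      rcases List.mem_cons.1 hj' with rfl | hj'
      · exact LinkPattern.skip_ne (s a)
      · have h1 := hne a j' hj'
        have h2 := hL.1 j' hj'
        dsimp only
        rcases lt_or_ge (s a).val j with h3 | h3
        · rw [LinkPattern.skip_val_of_lt h3]; exact h1
        · rw [LinkPattern.skip_val_of_le h3]; omega
    · intro π pos S h
      obtain ⟨ρ, S', h1, h2, h3, h4, h5⟩ := H _ _ _ (h.close hj)
      have hskip : ∀ c : Fin (2 * (n + (j :: L).length)), ∀ hc : c.val < j,
          LinkPattern.skip (n := n + L.length) j ⟨c.val, by omega⟩ = c := by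
        intro c hc
        exact Fin.ext (LinkPattern.skip_val_of_lt (i := ⟨c.val, by omega⟩) hc)
      -- The later indices and their successors lie below `j`, where `skip j` is the identity: with
      -- the highest arc closed first, no index needs relabelling.
      have key : ∀ T : Setoid X,
          (∀ a b : Fin (2 * (n + L.length)), a.val ∈ L → b.val = a.val + 1 →
            T ((pos ∘ LinkPattern.skip j) a) ((pos ∘ LinkPattern.skip j) b)) ↔
          (∀ a b, a.val ∈ L → b.val = a.val + 1 → T (pos a) (pos b)) := by
        intro T
        constructor
        · intro hT a b ha hab
          have := hL.1 _ ha
          have := hT ⟨a.val, by omega⟩ ⟨b.val, by omega⟩ ha hab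
          simpa only [Function.comp_apply, hskip a (by omega), hskip b (by omega)] using this
        · intro hT a b ha hab
          have := hL.1 _ ha
          have ea := LinkPattern.skip_val_of_lt (i := a) (j := j) (by omega)
          have eb := LinkPattern.skip_val_of_lt (i := b) (j := j) (by omega)
          exact hT _ _ (by rwa [ea]) (by rw [ea, eb, hab])
      refine ⟨ρ, S', ?_, h2, ?_, ?_, ?_⟩
      · rw [← h1]
        change closeList n L (closeOp (n + L.length) j (Finsupp.single π 1)) = _
        rw [closeOp_single hj]
      · exact fun x y hxy => h3 (Or.inl hxy)
      · intro a b ha hab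
        rcases List.mem_cons.1 ha with ha | ha
        · have ea : pos a = pos ⟨j, by omega⟩ := congrArg pos (Fin.ext ha)
          have eb : pos b = pos ⟨j + 1, hj⟩ := congrArg pos (Fin.ext (by rw [hab, ha]))
          rw [ea, eb]
          exact h3 (Or.inr (Or.inl ⟨S.refl _, S.refl _⟩))
        · exact (key S').1 h4 a b ha hab
      · intro T hST hT
        refine h5 T ?_ ((key T).2 fun a b ha => hT a b (by simp [ha]))
        have hab : T (pos ⟨j, by omega⟩) (pos ⟨j + 1, hj⟩) := hT _ _ (by simp) rfl
        rintro x y (hxy | ⟨hx, hy⟩ | ⟨hx, hy⟩)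
        · exact hST hxy
        · exact T.trans (hST hx) (T.trans hab (hST hy))
        · exact T.trans (hST hx) (T.trans (T.symm hab) (hST hy))

/-! ### Labels of the black terminations -/

section Labels

variable {N : ℕ} (τ : Fin (2 * N) → Bool)

/-- Counting the black terminations before a given one inverts their increasing enumeration. -/
theorem orderEmbOfFin_blackLabel {c : ℕ} (h : (blackTerms τ).card = c) {k : Fin (2 * N)}
    (hk : τ k = true) (x : Fin c) (hx : x.val = blackLabel τ k) :
    (blackTerms τ).orderEmbOfFin h x = k := by
  have hmem : k ∈ Set.range ((blackTerms τ).orderEmbOfFin h) := by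
    rw [Finset.range_orderEmbOfFin]; simp [blackTerms, hk]
  obtain ⟨y, rfl⟩ := hmem
  have h1 : (blackTerms τ).filter (fun l => l < (blackTerms τ).orderEmbOfFin h y) =
      (Finset.Iio y).map ((blackTerms τ).orderEmbOfFin h).toEmbedding := by
    ext l
    simp only [Finset.mem_filter, Finset.mem_map, Finset.mem_Iio]
    constructor
    · rintro ⟨h1, h2⟩
      have : l ∈ Set.range ((blackTerms τ).orderEmbOfFin h) := by
        rw [Finset.range_orderEmbOfFin]; exact h1
      obtain ⟨z, rfl⟩ := this
      exact ⟨z, by simpa using h2, rfl⟩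
    · rintro ⟨z, hz, rfl⟩
      exact ⟨Finset.orderEmbOfFin_mem _ h z, by simpa using hz⟩
  have h2 : blackLabel τ ((blackTerms τ).orderEmbOfFin h y) = y.val := by
    rw [blackLabel, h1]; simp
  rw [h2] at hx
  rw [Fin.ext hx]

theorem blackLabel_sndTerm {i : Fin N} (h : τ (fstTerm i) = true) :
    blackLabel τ (sndTerm i) = blackLabel τ (fstTerm i) + 1 := by
  have : (blackTerms τ).filter (fun l => l < sndTerm i) =
      insert (fstTerm i) ((blackTerms τ).filter fun l => l < fstTerm i) := by
    ext l
    simp only [Finset.mem_filter, Finset.mem_insert, blackTerms, Finset.mem_univ, true_and]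
    constructor
    · rintro ⟨h1, h2⟩
      by_cases hl : l = fstTerm i
      · exact Or.inl hl
      · refine Or.inr ⟨h1, ?_⟩
        simp only [fstTerm, sndTerm, Fin.ext_iff, Fin.lt_def] at *
        omega
    · rintro (rfl | ⟨h1, h2⟩)
      · exact ⟨h, by simp [fstTerm, sndTerm]⟩
      · refine ⟨h1, h2.trans ?_⟩
        simp [fstTerm, sndTerm]
  rw [blackLabel, this, Finset.card_insert_of_notMem (by simp), blackLabel]

theorem mem_bbPairs {i : Fin N} :
    i ∈ bbPairs τ ↔ τ (fstTerm i) = true ∧ τ (sndTerm i) = true := by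
  simp [bbPairs]

theorem mem_bbIndices {j : ℕ} :
    j ∈ bbIndices τ ↔ ∃ i ∈ bbPairs τ, blackLabel τ (fstTerm i) = j := by
  simp [bbIndices]

/-- The label after that of a first termination belongs to the second termination of the same pair,
so the arcs to be closed are disjoint. -/
theorem bbIndices_gap {j j' : ℕ} (hj : j ∈ bbIndices τ) (hj' : j' ∈ bbIndices τ) (h : j' < j) :
    j' + 1 < j := by
  obtain ⟨i, hi, rfl⟩ := (mem_bbIndices τ).1 hj
  obtain ⟨i', hi', rfl⟩ := (mem_bbIndices τ).1 hj'
  rw [mem_bbPairs] at hi hi'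
  rw [← blackLabel_sndTerm τ hi'.1]
  refine blackLabel_lt τ hi'.2 ?_
  by_contra hlt
  have hne : fstTerm i ≠ sndTerm i' := by
    simp only [fstTerm, sndTerm, ne_eq, Fin.ext_iff]; omega
  rcases lt_or_ge (fstTerm i) (fstTerm i') with h1 | h1
  · exact absurd (blackLabel_lt τ hi.1 h1) (by omega)
  · rcases h1.eq_or_lt with h2 | h2
    · rw [h2] at h; omega
    · simp only [fstTerm, sndTerm, ne_eq, Fin.ext_iff, Fin.lt_def] at *
      omega

theorem blackLabel_lt_card {k : Fin (2 * N)} (hk : τ k = true) :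
    blackLabel τ k < (blackTerms τ).card := by
  refine Finset.card_lt_card (Finset.ssubset_iff.2 ⟨k, by simp, ?_⟩)
  intro x hx
  simp only [Finset.mem_insert, Finset.mem_filter, blackTerms, Finset.mem_univ, true_and] at hx ⊢
  rcases hx with rfl | hx
  · exact hk
  · exact hx.1

theorem bbIndices_add_one_lt {j : ℕ} (hj : j ∈ bbIndices τ) : j + 1 < (blackTerms τ).card := by
  obtain ⟨i, hi, rfl⟩ := (mem_bbIndices τ).1 hj
  rw [mem_bbPairs] at hi
  rw [← blackLabel_sndTerm τ hi.1]
  exact blackLabel_lt_card τ hi.2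

theorem mem_mixedPairs {i : Fin N} : i ∈ mixedPairs τ ↔ τ (fstTerm i) ≠ τ (sndTerm i) := by
  simp [mixedPairs]

/-- A black termination of a pair that is not coloured (white, white). -/
def pairBlack (i : Fin N) : Fin (2 * N) := if τ (fstTerm i) = true then fstTerm i else sndTerm i

/-- The pair of a termination. -/
def pairOf {N : ℕ} (k : Fin (2 * N)) : Fin N := ⟨k.val / 2, by omega⟩

theorem eq_fstTerm_or_sndTerm (k : Fin (2 * N)) :
    k = fstTerm (pairOf k) ∨ k = sndTerm (pairOf k) := by
  simp only [fstTerm, sndTerm, pairOf, Fin.ext_iff]; omega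

variable {X : Type*}

/-- The equivalence relation generated by `S` and the gluing of the pairs of black terminations. -/
def glueSetoid (S : Setoid X) (pos : Fin (2 * N) → X) : Setoid X :=
  sInf {T | S ≤ T ∧ ∀ i ∈ bbPairs τ, T (pos (fstTerm i)) (pos (sndTerm i))}

theorem le_glueSetoid (S : Setoid X) (pos : Fin (2 * N) → X) : S ≤ glueSetoid τ S pos :=
  le_sInf fun _ hT => hT.1

theorem glueSetoid_pair (S : Setoid X) (pos : Fin (2 * N) → X) {i : Fin N} (hi : i ∈ bbPairs τ) :
    glueSetoid τ S pos (pos (fstTerm i)) (pos (sndTerm i)) :=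
  fun _ hT => hT.2 i hi

theorem glueSetoid_le {S T : Setoid X} {pos : Fin (2 * N) → X} (h : S ≤ T)
    (h' : ∀ i ∈ bbPairs τ, T (pos (fstTerm i)) (pos (sndTerm i))) : glueSetoid τ S pos ≤ T :=
  sInf_le ⟨h, h'⟩

/-- The surviving labels lie in distinct mixed pairs and keep their order, hence they enumerate the
mixed pairs increasingly. The relation `S'` and `glueSetoid` have the same universal property: the
smallest relation above `S` that identifies the ends of each black pair. -/
theorem exists_closeList_bbIndices {n : ℕ} (hn : (mixedPairs τ).card = 2 * n) (L : List ℕ)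
    (hmem : ∀ j, j ∈ L ↔ j ∈ bbIndices τ) (hpw : L.Pairwise fun a b => b + 1 < a)
    (hcard : (blackTerms τ).card = 2 * (n + L.length)) {π : LinkPattern (n + L.length)}
    {pos : Fin (2 * N) → X} {S : Setoid X}
    (hπ : π.Represents (pos ∘ (blackTerms τ).orderEmbOfFin hcard) S) :
    ∃ ρ : LinkPattern n, closeList n L (Finsupp.single π 1) = Finsupp.single ρ 1 ∧
      ρ.Represents (pos ∘ pairBlack τ ∘ (mixedPairs τ).orderEmbOfFin hn)
        (glueSetoid τ S pos) := by
  set emb := (blackTerms τ).orderEmbOfFin hcard with hemb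
  have hb : ∀ j ∈ L, j + 1 < 2 * (n + L.length) := fun j hj => by
    have := bbIndices_add_one_lt τ ((hmem j).1 hj)
    omega
  obtain ⟨s, hs, hne, H⟩ := exists_closeList_single (X := X) n L hpw hb
  obtain ⟨ρ, S', h1, h2, h3, h4, h5⟩ := H π _ S hπ
  have hblack : ∀ x, τ (emb x) = true := fun x => by
    have := Finset.orderEmbOfFin_mem (blackTerms τ) hcard x
    exact (Finset.mem_filter.1 this).2
  have hbb : ∀ i ∈ bbPairs τ, ∃ x y, x.val ∈ L ∧ y.val = x.val + 1 ∧ emb x = fstTerm i ∧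
      emb y = sndTerm i := fun i hi => by
    have hj : blackLabel τ (fstTerm i) ∈ L := (hmem _).2 ((mem_bbIndices τ).2 ⟨i, hi, rfl⟩)
    have hlt := hb _ hj
    have hi' := (mem_bbPairs τ).1 hi
    exact ⟨⟨blackLabel τ (fstTerm i), by omega⟩, ⟨_, hlt⟩, hj, rfl, orderEmbOfFin_blackLabel τ hcard hi'.1 _ rfl,
      orderEmbOfFin_blackLabel τ hcard hi'.2 _ (blackLabel_sndTerm τ hi'.1).symm⟩
  have hbb' : ∀ x y, x.val ∈ L → y.val = x.val + 1 → ∃ i ∈ bbPairs τ, emb x = fstTerm i ∧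
      emb y = sndTerm i := fun x y hx hxy => by
    obtain ⟨i, hi, hix⟩ := (mem_bbIndices τ).1 ((hmem _).1 hx)
    have hi' := (mem_bbPairs τ).1 hi
    refine ⟨i, hi, orderEmbOfFin_blackLabel τ hcard hi'.1 _ hix.symm,
      orderEmbOfFin_blackLabel τ hcard hi'.2 _ ?_⟩
    rw [blackLabel_sndTerm τ hi'.1, hxy, hix]
  have hnotbb : ∀ a, pairOf (emb (s a)) ∉ bbPairs τ := fun a ha => by
    obtain ⟨x, y, hx, hxy, hx', hy'⟩ := hbb _ ha
    have := hne a _ hx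
    rcases eq_fstTerm_or_sndTerm (emb (s a)) with h | h
    · rw [← hx'] at h
      exact this.1 (congrArg Fin.val (emb.injective h))
    · rw [← hy'] at h
      exact this.2 ((congrArg Fin.val (emb.injective h)).trans hxy)
  have hmixed : ∀ a, pairOf (emb (s a)) ∈ mixedPairs τ := fun a => by
    have h6 := hnotbb a
    have h7 := hblack (s a)
    rw [mem_bbPairs] at h6
    rw [mem_mixedPairs]
    intro h8
    rcases eq_fstTerm_or_sndTerm (emb (s a)) with h | h <;> rw [h] at h7
    · exact h6 ⟨h7, h8 ▸ h7⟩
    · exact h6 ⟨h8.symm ▸ h7, h7⟩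
  have hpb : ∀ a, pairBlack τ (pairOf (emb (s a))) = emb (s a) := fun a => by
    have h6 := (mem_mixedPairs τ).1 (hmixed a)
    have h7 := hblack (s a)
    unfold pairBlack
    rcases eq_fstTerm_or_sndTerm (emb (s a)) with h | h
    · rw [← h, if_pos h7]
    · rw [← h] at h6 ⊢
      rw [if_neg]
      intro h8
      rw [h8, h7] at h6
      exact h6 rfl
  have hmono : StrictMono fun a => pairOf (emb (s a)) := fun a b hab => by
    have h6 : emb (s a) < emb (s b) := emb.strictMono (hs hab)
    refine lt_of_le_of_ne ?_ ?_
    · simp only [pairOf, Fin.le_def, Fin.lt_def] at h6 ⊢; omega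
    -- `pairBlack` recovers a survivor from its pair, so two survivors cannot share a pair.
    · intro h7
      have h8 := hpb a
      rw [show pairOf (emb (s a)) = pairOf (emb (s b)) from h7, hpb b] at h8
      exact h6.ne' h8
  have hfun : (fun a => pairOf (emb (s a))) = (mixedPairs τ).orderEmbOfFin hn :=
    Finset.orderEmbOfFin_unique hn hmixed hmono
  have hS' : S' = glueSetoid τ S pos := by
    refine le_antisymm (h5 _ (le_glueSetoid τ S pos) ?_) (glueSetoid_le τ h3 ?_)
    · intro a b ha hab
      obtain ⟨i, hi, e1, e2⟩ := hbb' a b ha hab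
      simp only [Function.comp_apply, e1, e2]
      exact glueSetoid_pair τ S pos hi
    · intro i hi
      obtain ⟨x, y, hx, hxy, hx', hy'⟩ := hbb i hi
      rw [← hx', ← hy']
      exact h4 x y hx hxy
  refine ⟨ρ, h1, ?_⟩
  rw [← hS', ← hfun]
  have hc : pos ∘ pairBlack τ ∘ (fun a => pairOf (emb (s a))) = (pos ∘ emb) ∘ s :=
    funext fun a => congrArg pos (hpb a)
  rw [hc]
  exact h2

/-- The product of the closing operators over the (black, black) pairs leaves the mixed pairs, with
the connectivity that results from gluing the (black, black) pairs. -/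
theorem exists_closeProd_single {n : ℕ} (hn : (mixedPairs τ).card = 2 * n)
    {π : LinkPattern (n + ((bbIndices τ).sort (· ≥ ·)).length)} {pos : Fin (2 * N) → X}
    {S : Setoid X}
    (hπ : π.Represents (pos ∘ (blackTerms τ).orderEmbOfFin (card_blackTerms_eq τ hn)) S) :
    ∃ ρ : LinkPattern n, closeProd n (bbIndices τ) (Finsupp.single π 1) = Finsupp.single ρ 1 ∧
      ρ.Represents (pos ∘ pairBlack τ ∘ (mixedPairs τ).orderEmbOfFin hn)
        (glueSetoid τ S pos) := by
  have hmem : ∀ j, j ∈ (bbIndices τ).sort (· ≥ ·) ↔ j ∈ bbIndices τ := fun j => by simp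
  refine exists_closeList_bbIndices τ hn _ hmem ?_ _ hπ
  have h1 : ((bbIndices τ).sort (· ≥ ·)).Pairwise (· > ·) := Finset.sortedGT_sort _ |>.pairwise
  exact h1.imp_of_mem fun {a b} ha hb hab => bbIndices_gap τ ((hmem a).1 ha) ((hmem b).1 hb) hab

end Labels

/-! ### Edges, plaquettes and terminations -/

theorem mem_edgesAt {e : LatticeEdge} {v : ℤ × ℤ} : e ∈ edgesAt v ↔ e.src = v ∨ e.tgt = v := by
  obtain ⟨a, b⟩ := v
  cases e <;> simp [edgesAt, LatticeEdge.src, LatticeEdge.tgt] <;> omega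

namespace LatticeEdge

/-- The plaquette below or on the left of an edge. -/
def lowFace : LatticeEdge → ℤ × ℤ
  | horiz x y => (x, y - 1)
  | vert x y => (x - 1, y)

/-- The plaquette above or on the right of an edge. -/
def highFace : LatticeEdge → ℤ × ℤ
  | horiz x y => (x, y)
  | vert x y => (x, y)

end LatticeEdge

/-- The plaquettes with the same parity as `s`. -/
def SameParity (s p : ℤ × ℤ) : Prop := Even ((p.1 + p.2) - (s.1 + s.2))

open Classical in
/-- The plaquette around the edge `e` with the same parity as `s`. -/
noncomputable def parityPlaquette (s : ℤ × ℤ) (e : LatticeEdge) : ℤ × ℤ :=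
  if SameParity s e.highFace then e.highFace else e.lowFace

theorem mem_plaquetteEdges {e : LatticeEdge} {p : ℤ × ℤ} :
    e ∈ plaquetteEdges p ↔ e.lowFace = p ∨ e.highFace = p := by
  obtain ⟨a, b⟩ := p
  cases e <;> simp [plaquetteEdges, LatticeEdge.lowFace, LatticeEdge.highFace] <;> omega

/-- The two plaquettes along an edge are neighbours, so exactly one has the required parity; this is
why the plaquettes of one parity partition the edges. -/
theorem sameParity_lowFace (s : ℤ × ℤ) (e : LatticeEdge) :
    SameParity s e.lowFace ↔ ¬ SameParity s e.highFace := by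
  cases e <;> simp only [SameParity, LatticeEdge.lowFace, LatticeEdge.highFace, Int.even_iff] <;>
    omega

theorem parityPlaquette_eq_iff {s p : ℤ × ℤ} {e : LatticeEdge} :
    parityPlaquette s e = p ↔ e ∈ plaquetteEdges p ∧ SameParity s p := by
  have h := sameParity_lowFace s e
  rw [mem_plaquetteEdges]
  unfold parityPlaquette
  split_ifs with h1
  · constructor
    · rintro rfl; exact ⟨Or.inr rfl, h1⟩
    · rintro ⟨rfl | rfl, h2⟩
      · exact absurd h1 (h.1 h2)
      · rfl
  · constructor
    · rintro rfl; exact ⟨Or.inl rfl, h.2 h1⟩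
    · rintro ⟨rfl | rfl, h2⟩
      · rfl
      · exact absurd h2 h1

namespace Dir

theorem crossed_faces (p : ℤ × ℤ) (d : Dir) :
    ((d.crossed p).lowFace = p ∧ (d.crossed p).highFace = p + d.vec) ∨
      ((d.crossed p).lowFace = p + d.vec ∧ (d.crossed p).highFace = p) := by
  obtain ⟨a, b⟩ := p
  cases d <;> simp [crossed, vec, LatticeEdge.lowFace, LatticeEdge.highFace] <;> omega

theorem crossed_ends (p : ℤ × ℤ) (d : Dir) :
    ((d.crossed p).src = d.left p ∧ (d.crossed p).tgt = d.right p) ∨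
      ((d.crossed p).src = d.right p ∧ (d.crossed p).tgt = d.left p) := by
  cases d <;> simp [crossed, left, right, LatticeEdge.src, LatticeEdge.tgt]

/-- An edge can be crossed in two senses only: the same sense forces the same starting plaquette,
the opposite one exchanges left and right. -/
theorem crossed_eq_crossed {p p' : ℤ × ℤ} {d d' : Dir} (h : d.crossed p = d'.crossed p') :
    p = p' ∨ d.left p = d'.right p' := by
  obtain ⟨a, b⟩ := p
  obtain ⟨a', b'⟩ := p'
  cases d <;> cases d' <;> simp [crossed, left, right] at h ⊢ <;> omega

end Dir

/-! ### Boundary edges, terminations and their plaquettes -/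

namespace LatticeDomain

variable {N : ℕ} (Λ : LatticeDomain N)

theorem mem_edges_iff {e : LatticeEdge} :
    e ∈ Λ.verts.biUnion edgesAt ↔ e.src ∈ Λ.verts ∨ e.tgt ∈ Λ.verts := by
  simp only [Finset.mem_biUnion, mem_edgesAt]
  constructor
  · rintro ⟨v, hv, rfl | rfl⟩
    · exact Or.inl hv
    · exact Or.inr hv
  · rintro (h | h)
    · exact ⟨_, h, Or.inl rfl⟩
    · exact ⟨_, h, Or.inr rfl⟩

/-- An edge with exactly one endpoint in the region. -/
def IsBoundary (e : LatticeEdge) : Prop := ¬ (e.src ∈ Λ.verts ↔ e.tgt ∈ Λ.verts)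

theorem isBoundary_crossed (k : ZMod (2 * N)) :
    Λ.IsBoundary ((Λ.dir k).crossed (Λ.corner k)) := by
  have h1 := Λ.left_mem k
  have h2 := Λ.right_notMem k
  unfold IsBoundary
  rcases Dir.crossed_ends (Λ.corner k) (Λ.dir k) with ⟨h3, h4⟩ | ⟨h3, h4⟩ <;> rw [h3, h4] <;> tauto

theorem isBoundary_term (k : Fin (2 * N)) : Λ.IsBoundary (Λ.term k).val :=
  Λ.isBoundary_crossed _

theorem natCast_inj {a b : ℕ} (ha : a < 2 * N) (hb : b < 2 * N)
    (h : (a : ZMod (2 * N)) = b) : a = b := by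
  rw [ZMod.natCast_eq_natCast_iff', Nat.mod_eq_of_lt ha, Nat.mod_eq_of_lt hb] at h
  exact h

/-- Simplicity of the path excludes a second crossing in the same sense; one in the opposite sense
would put a vertex both inside and outside the region. -/
theorem term_injective : Function.Injective Λ.term := fun k l h => by
  have h1 : (Λ.term k).val = (Λ.term l).val := congrArg _ h
  rcases Dir.crossed_eq_crossed h1 with h2 | h2
  · exact Fin.ext (natCast_inj k.2 l.2 (Λ.corner_injective h2))
  · exact absurd (Λ.left_mem k.val) (h2 ▸ Λ.right_notMem l.val)

theorem exists_term_eq {e : LatticeEdge} (h : Λ.IsBoundary e) : ∃ k, (Λ.term k).val = e := by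
  have : NeZero (2 * N) := ⟨by have := Λ.pos; omega⟩
  obtain ⟨k, hk⟩ := Λ.boundary_crossed e h
  refine ⟨⟨k.val, ZMod.val_lt k⟩, ?_⟩
  rw [← hk]
  simp [term]

theorem mem_plaquetteEdges_term {k : Fin (2 * N)} {p : ℤ × ℤ} :
    (Λ.term k).val ∈ plaquetteEdges p ↔
      Λ.corner (k.val : ZMod (2 * N)) = p ∨ Λ.corner ((k.val + 1 : ℕ) : ZMod (2 * N)) = p := by
  rw [mem_plaquetteEdges, Nat.cast_add, Nat.cast_one, Λ.corner_succ]
  have := Dir.crossed_faces (Λ.corner (k.val : ZMod (2 * N))) (Λ.dir (k.val : ZMod (2 * N)))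
  rcases this with ⟨h1, h2⟩ | ⟨h1, h2⟩ <;> simp only [term, h1, h2]
  exact or_comm

/-- Each unit step changes the parity, so every other corner has the parity of `corner 1`. -/
theorem sameParity_corner (i : ℕ) :
    SameParity (Λ.corner 1) (Λ.corner ((2 * i + 1 : ℕ) : ZMod (2 * N))) := by
  induction i with
  | zero => simp [SameParity]
  | succ i ih =>
    have h : ((2 * (i + 1) + 1 : ℕ) : ZMod (2 * N)) = ((2 * i + 1 : ℕ) : ZMod (2 * N)) + 1 + 1 := by
      push_cast; ring
    have hd : ∀ d : Dir, (d.vec.1 + d.vec.2) % 2 = 1 := fun d => by cases d <;> simp [Dir.vec]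
    rw [h, Λ.corner_succ, Λ.corner_succ]
    have h1 := hd (Λ.dir ((2 * i + 1 : ℕ) : ZMod (2 * N)))
    have h2 := hd (Λ.dir (((2 * i + 1 : ℕ) : ZMod (2 * N)) + 1))
    simp only [SameParity, Int.even_iff, Prod.fst_add, Prod.snd_add] at ih ⊢
    omega

/-- The plaquette of the gyration around an edge. -/
noncomputable def plaq (e : LatticeEdge) : ℤ × ℤ := parityPlaquette (Λ.corner 1) e

/-- The plaquette between the two terminations of a pair. -/
def pairCorner (i : Fin N) : ℤ × ℤ := Λ.corner ((2 * i.val + 1 : ℕ) : ZMod (2 * N))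

theorem plaq_fstTerm (i : Fin N) : Λ.plaq (Λ.term (fstTerm i)).val = Λ.pairCorner i :=
  parityPlaquette_eq_iff.2
    ⟨Λ.mem_plaquetteEdges_term.2 (Or.inr rfl), Λ.sameParity_corner i⟩

theorem plaq_sndTerm (i : Fin N) : Λ.plaq (Λ.term (sndTerm i)).val = Λ.pairCorner i :=
  parityPlaquette_eq_iff.2
    ⟨Λ.mem_plaquetteEdges_term.2 (Or.inl rfl), Λ.sameParity_corner i⟩

theorem plaq_term (k : Fin (2 * N)) : Λ.plaq (Λ.term k).val = Λ.pairCorner (pairOf k) := by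
  rcases eq_fstTerm_or_sndTerm k with h | h
  · rw [← plaq_fstTerm, ← h]
  · rw [← plaq_sndTerm, ← h]

theorem pairCorner_injective : Function.Injective Λ.pairCorner := fun i j h => by
  have := natCast_inj (N := N) (by omega) (by omega) (Λ.corner_injective h)
  exact Fin.ext (by omega)

/-- Two boundary edges around a plaquette of the gyration are the terminations of a pair. -/
theorem exists_pair_of_plaq_eq {e f : Λ.Edge} (he : Λ.IsBoundary e.val) (hf : Λ.IsBoundary f.val)
    (hef : e ≠ f) (h : Λ.plaq e.val = Λ.plaq f.val) :
    ∃ i, (e = Λ.term (fstTerm i) ∧ f = Λ.term (sndTerm i)) ∨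
      (e = Λ.term (sndTerm i) ∧ f = Λ.term (fstTerm i)) := by
  obtain ⟨k, hk⟩ := Λ.exists_term_eq he
  obtain ⟨l, hl⟩ := Λ.exists_term_eq hf
  obtain rfl : Λ.term k = e := Subtype.ext hk
  obtain rfl : Λ.term l = f := Subtype.ext hl
  rw [plaq_term, plaq_term] at h
  have h1 := Λ.pairCorner_injective h
  refine ⟨pairOf k, ?_⟩
  rcases eq_fstTerm_or_sndTerm k with h2 | h2 <;> rcases eq_fstTerm_or_sndTerm l with h3 | h3
  · exact absurd (congrArg Λ.term (h2.trans (h1 ▸ h3.symm))) hef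
  · exact Or.inl ⟨congrArg _ h2, congrArg _ (h1 ▸ h3)⟩
  · exact Or.inr ⟨congrArg _ h2, congrArg _ (h1 ▸ h3)⟩
  · exact absurd (congrArg Λ.term (h2.trans (h1 ▸ h3.symm))) hef

end LatticeDomain

/-! ### The gyration -/

/-- The four edges at a vertex form two pairs around two opposite plaquettes. -/
theorem exists_edgesAt_eq (s v : ℤ × ℤ) : ∃ a b c d : LatticeEdge, edgesAt v = {a, b, c, d} ∧
    a ≠ b ∧ a ≠ c ∧ a ≠ d ∧ b ≠ c ∧ b ≠ d ∧ c ≠ d ∧ parityPlaquette s a = parityPlaquette s b ∧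
    parityPlaquette s c = parityPlaquette s d := by
  obtain ⟨x, y⟩ := v
  have hp : ∀ (e f : LatticeEdge) (p : ℤ × ℤ), e ∈ plaquetteEdges p → f ∈ plaquetteEdges p →
      SameParity s p → parityPlaquette s e = parityPlaquette s f := fun e f p h1 h2 h3 =>
    (parityPlaquette_eq_iff.2 ⟨h1, h3⟩).trans (parityPlaquette_eq_iff.2 ⟨h2, h3⟩).symm
  by_cases h : SameParity s (x, y)
  · have h' : SameParity s (x - 1, y - 1) := by
      simp only [SameParity, Int.even_iff] at h ⊢; omega
    refine ⟨.horiz x y, .vert x y, .horiz (x - 1) y, .vert x (y - 1), ?_, ?_, ?_, ?_, ?_, ?_, ?_,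
      ?_, ?_⟩
    · ext e; simp only [edgesAt, Finset.mem_insert, Finset.mem_singleton]; tauto
    any_goals (simp only [ne_eq, LatticeEdge.horiz.injEq, LatticeEdge.vert.injEq, reduceCtorEq,
      not_false_eq_true]; try omega)
    · exact hp _ _ (x, y) (by simp [plaquetteEdges]) (by simp [plaquetteEdges]) h
    · exact hp _ _ (x - 1, y - 1) (by simp [plaquetteEdges]) (by simp [plaquetteEdges]) h'
  · have h1 : SameParity s (x - 1, y) := by
      simp only [SameParity, Int.even_iff] at h ⊢; omega
    have h2 : SameParity s (x, y - 1) := by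
      simp only [SameParity, Int.even_iff] at h ⊢; omega
    refine ⟨.horiz x y, .vert x (y - 1), .horiz (x - 1) y, .vert x y, ?_, ?_, ?_, ?_, ?_, ?_, ?_,
      ?_, ?_⟩
    · ext e; simp only [edgesAt, Finset.mem_insert, Finset.mem_singleton]; tauto
    any_goals (simp only [ne_eq, LatticeEdge.horiz.injEq, LatticeEdge.vert.injEq, reduceCtorEq,
      not_false_eq_true]; try omega)
    · exact hp _ _ (x, y - 1) (by simp [plaquetteEdges]) (by simp [plaquetteEdges]) h2
    · exact hp _ _ (x - 1, y) (by simp [plaquetteEdges]) (by simp [plaquetteEdges]) h1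

theorem exists_partner_edge (s : ℤ × ℤ) {v : ℤ × ℤ} {e : LatticeEdge} (he : e ∈ edgesAt v) :
    ∃ f ∈ edgesAt v, f ≠ e ∧ parityPlaquette s f = parityPlaquette s e := by
  obtain ⟨a, b, c, d, h, hab, hac, had, hbc, hbd, hcd, h1, h2⟩ := exists_edgesAt_eq s v
  rw [h] at he ⊢
  simp only [Finset.mem_insert, Finset.mem_singleton] at he
  rcases he with rfl | rfl | rfl | rfl
  · exact ⟨b, by simp, hab.symm, h1.symm⟩
  · exact ⟨a, by simp, hab, h1⟩
  · exact ⟨d, by simp, hcd.symm, h2.symm⟩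
  · exact ⟨c, by simp, hcd, h2⟩

/-- Two edges around a plaquette are adjacent or opposite. -/
theorem adjacent_or_opposite {p : ℤ × ℤ} {e f : LatticeEdge} (he : e ∈ plaquetteEdges p)
    (hf : f ∈ plaquetteEdges p) (hef : e ≠ f) :
    (∃ v, e ∈ edgesAt v ∧ f ∈ edgesAt v) ∨
      ∃ g h : LatticeEdge, ∃ u₁ u₂ u₃ u₄ : ℤ × ℤ,
        plaquetteEdges p = {e, f, g, h} ∧ e ≠ g ∧ e ≠ h ∧ f ≠ g ∧ f ≠ h ∧ g ≠ h ∧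
        (∀ v, e ∈ edgesAt v ↔ v = u₁ ∨ v = u₃) ∧ (∀ v, f ∈ edgesAt v ↔ v = u₂ ∨ v = u₄) ∧
        (∀ v, g ∈ edgesAt v ↔ v = u₁ ∨ v = u₂) ∧ (∀ v, h ∈ edgesAt v ↔ v = u₃ ∨ v = u₄) ∧
        u₁ ≠ u₂ ∧ u₁ ≠ u₃ ∧ u₁ ≠ u₄ ∧ u₂ ≠ u₃ ∧ u₂ ≠ u₄ ∧ u₃ ≠ u₄ := by
  obtain ⟨a, b⟩ := p
  have hB : ∀ v, LatticeEdge.horiz a b ∈ edgesAt v ↔ v = (a, b) ∨ v = (a + 1, b) := fun v => by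
    rw [mem_edgesAt]; simp [LatticeEdge.src, LatticeEdge.tgt, eq_comm]
  have hT : ∀ v, LatticeEdge.horiz a (b + 1) ∈ edgesAt v ↔
      v = (a, b + 1) ∨ v = (a + 1, b + 1) := fun v => by
    rw [mem_edgesAt]; simp [LatticeEdge.src, LatticeEdge.tgt, eq_comm]
  have hL : ∀ v, LatticeEdge.vert a b ∈ edgesAt v ↔ v = (a, b) ∨ v = (a, b + 1) := fun v => by
    rw [mem_edgesAt]; simp [LatticeEdge.src, LatticeEdge.tgt, eq_comm]
  have hR : ∀ v, LatticeEdge.vert (a + 1) b ∈ edgesAt v ↔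
      v = (a + 1, b) ∨ v = (a + 1, b + 1) := fun v => by
    rw [mem_edgesAt]; simp [LatticeEdge.src, LatticeEdge.tgt, eq_comm]
  have hp : plaquetteEdges (a, b) = {.horiz a b, .horiz a (b + 1), .vert a b, .vert (a + 1) b} :=
    rfl
  have perm : ∀ w x y z : LatticeEdge, ({w, x, y, z} : Finset LatticeEdge) = {x, w, y, z} ∧
      ({w, x, y, z} : Finset LatticeEdge) = {y, z, w, x} ∧
      ({w, x, y, z} : Finset LatticeEdge) = {z, y, w, x} := fun w x y z => by
    refine ⟨?_, ?_, ?_⟩ <;> ext e <;> simp only [Finset.mem_insert, Finset.mem_singleton] <;> tauto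
  simp only [plaquetteEdges, Finset.mem_insert, Finset.mem_singleton] at he hf
  rcases he with rfl | rfl | rfl | rfl <;> rcases hf with rfl | rfl | rfl | rfl
  all_goals first
    | exact absurd rfl hef
    | refine Or.inl ⟨(a, b), ?_⟩
      simp [hB, hL]
      done
    | refine Or.inl ⟨(a + 1, b), ?_⟩
      simp [hB, hR]
      done
    | refine Or.inl ⟨(a, b + 1), ?_⟩
      simp [hT, hL]
      done
    | refine Or.inl ⟨(a + 1, b + 1), ?_⟩
      simp [hT, hR]
      done
    | refine Or.inr ⟨_, _, (a, b), (a, b + 1), (a + 1, b), (a + 1, b + 1), hp, ?_⟩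
      simp [hB, hT, hL, hR]
    | refine Or.inr ⟨_, _, (a, b + 1), (a, b), (a + 1, b + 1), (a + 1, b), hp.trans (perm _ _ _ _).1,
        ?_⟩
      simp [hB, hT, hL, hR, or_comm]
    | refine Or.inr ⟨_, _, (a, b), (a + 1, b), (a, b + 1), (a + 1, b + 1),
        hp.trans (perm _ _ _ _).2.1, ?_⟩
      simp [hB, hT, hL, hR]
    | refine Or.inr ⟨_, _, (a + 1, b), (a, b), (a + 1, b + 1), (a, b + 1),
        hp.trans (perm _ _ _ _).2.2, ?_⟩
      simp [hB, hT, hL, hR, or_comm]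

namespace LatticeDomain

variable {N : ℕ} (Λ : LatticeDomain N)

/-- The colour of a lattice edge, with value `false` outside of the domain. -/
noncomputable def color (φ : Λ.Edge → Bool) (e : LatticeEdge) : Bool :=
  if h : e ∈ Λ.verts.biUnion edgesAt then φ ⟨e, h⟩ else false

theorem color_val (φ : Λ.Edge → Bool) (e : Λ.Edge) : Λ.color φ e.val = φ e := by
  simp only [color, e.2, dif_pos]

theorem mem_edges_of_mem {v : ℤ × ℤ} (hv : v ∈ Λ.verts) {e : LatticeEdge} (he : e ∈ edgesAt v) :
    e ∈ Λ.verts.biUnion edgesAt :=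
  Finset.mem_biUnion.2 ⟨v, hv, he⟩

theorem card_colored_eq (φ : Λ.Edge → Bool) {v : ℤ × ℤ} (hv : v ∈ Λ.verts) (c : Bool) :
    (Finset.univ.filter fun e : Λ.Edge => e.val ∈ edgesAt v ∧ φ e = c).card =
      ((edgesAt v).filter fun e => Λ.color φ e = c).card := by
  refine Finset.card_bij (fun e _ => e.val) ?_ ?_ ?_
  · intro e he
    simp only [Finset.mem_filter, Finset.mem_univ, true_and] at he ⊢
    rw [color_val]; exact he
  · intro e _ f _ h
    exact Subtype.ext h
  · intro e he
    simp only [Finset.mem_filter] at he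
    refine ⟨⟨e, Λ.mem_edges_of_mem hv he.1⟩, ?_, rfl⟩
    simp only [Finset.mem_filter, Finset.mem_univ, true_and]
    exact ⟨he.1, (Λ.color_val φ _).symm.trans he.2⟩

theorem isFPL_iff {φ : Λ.Edge → Bool} :
    Λ.IsFPL φ ↔ ∀ v ∈ Λ.verts, ∀ c : Bool,
      ((edgesAt v).filter fun e => Λ.color φ e = c).card = 2 := by
  refine forall_congr' fun v => forall_congr' fun hv => forall_congr' fun c => ?_
  rw [card_colored_eq Λ φ hv]

/-- The plaquettes left unchanged by the gyration: the interior plaquettes around which the colours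
alternate. -/
def Alternating (φ : Λ.Edge → Bool) (p : ℤ × ℤ) : Prop :=
  (∀ e ∈ plaquetteEdges p, e.src ∈ Λ.verts ∧ e.tgt ∈ Λ.verts) ∧
    ∀ e ∈ plaquetteEdges p, ∀ f ∈ plaquetteEdges p, ∀ v, e ∈ edgesAt v → f ∈ edgesAt v → e ≠ f →
      Λ.color φ e ≠ Λ.color φ f

open Classical in
/-- The gyration: the colours are inverted around the non-alternating plaquettes. -/
noncomputable def gyrate (φ : Λ.Edge → Bool) (e : Λ.Edge) : Bool :=
  if Λ.Alternating φ (Λ.plaq e.val) then φ e else !φ e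

theorem gyrate_of_alternating {φ : Λ.Edge → Bool} {e : Λ.Edge}
    (h : Λ.Alternating φ (Λ.plaq e.val)) : Λ.gyrate φ e = φ e := if_pos h

theorem gyrate_of_not_alternating {φ : Λ.Edge → Bool} {e : Λ.Edge}
    (h : ¬ Λ.Alternating φ (Λ.plaq e.val)) : Λ.gyrate φ e = !φ e := if_neg h

theorem mem_plaq (e : LatticeEdge) : e ∈ plaquetteEdges (Λ.plaq e) :=
  (parityPlaquette_eq_iff.1 rfl).1

theorem sameParity_plaq (e : LatticeEdge) : SameParity (Λ.corner 1) (Λ.plaq e) :=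
  (parityPlaquette_eq_iff.1 rfl).2

theorem plaq_eq_of_mem {e f : LatticeEdge} (h : f ∈ plaquetteEdges (Λ.plaq e)) :
    Λ.plaq f = Λ.plaq e :=
  parityPlaquette_eq_iff.2 ⟨h, Λ.sameParity_plaq e⟩

/-- `Alternating` requires interior edges; this makes the gyration flip every termination. -/
theorem not_alternating_of_isBoundary (φ : Λ.Edge → Bool) {e : LatticeEdge}
    (h : Λ.IsBoundary e) : ¬ Λ.Alternating φ (Λ.plaq e) := fun h' => by
  have := h'.1 e (Λ.mem_plaq e)
  exact h (by simp [this.1, this.2])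

/-- All the edges around such a plaquette are kept or flipped together, which does not affect
whether two of them differ in colour. -/
theorem alternating_gyrate (φ : Λ.Edge → Bool) (e : LatticeEdge) :
    Λ.Alternating (Λ.gyrate φ) (Λ.plaq e) ↔ Λ.Alternating φ (Λ.plaq e) := by
  refine and_congr_right fun h => ?_
  refine forall_congr' fun f => forall_congr' fun hf => forall_congr' fun g =>
    forall_congr' fun hg => ?_
  have hf' := Λ.plaq_eq_of_mem hf
  have hg' := Λ.plaq_eq_of_mem hg
  have hfm := Λ.mem_edges_iff.2 (Or.inl (h f hf).1)
  have hgm := Λ.mem_edges_iff.2 (Or.inl (h g hg).1)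
  simp only [color, hfm, hgm, dif_pos]
  by_cases hk : Λ.Alternating φ (Λ.plaq e)
  · rw [gyrate_of_alternating _ (by rwa [hf']), gyrate_of_alternating _ (by rwa [hg'])]
  · rw [gyrate_of_not_alternating _ (by rwa [hf']), gyrate_of_not_alternating _ (by rwa [hg'])]
    simp

theorem gyrate_gyrate (φ : Λ.Edge → Bool) : Λ.gyrate (Λ.gyrate φ) = φ := by
  funext e
  by_cases hk : Λ.Alternating φ (Λ.plaq e.val)
  · rw [gyrate_of_alternating _ ((Λ.alternating_gyrate φ _).2 hk), gyrate_of_alternating _ hk]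
  · rw [gyrate_of_not_alternating _ (mt (Λ.alternating_gyrate φ _).1 hk),
      gyrate_of_not_alternating _ hk, Bool.not_not]

theorem card_filter_four {a b c d : LatticeEdge} (hab : a ≠ b) (hac : a ≠ c) (had : a ≠ d)
    (hbc : b ≠ c) (hbd : b ≠ d) (hcd : c ≠ d) (ψ : LatticeEdge → Bool) (x : Bool) :
    (({a, b, c, d} : Finset LatticeEdge).filter fun e => ψ e = x).card =
      (if ψ a = x then 1 else 0) + (if ψ b = x then 1 else 0) + (if ψ c = x then 1 else 0) +
        (if ψ d = x then 1 else 0) := by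
  rw [Finset.card_filter, Finset.sum_insert (by simp [hab, hac, had]),
    Finset.sum_insert (by simp [hbc, hbd]), Finset.sum_insert (by simp [hcd]),
    Finset.sum_singleton]
  ring

open Classical in
-- The two edges of an alternating plaquette at `v` have opposite colours. If only one of the two
-- plaquettes alternates, the other pair therefore also has one edge of each colour, and flipping it
-- is harmless; if neither alternates, all four edges flip.
theorem isFPL_gyrate {φ : Λ.Edge → Bool} (h : Λ.IsFPL φ) : Λ.IsFPL (Λ.gyrate φ) := by
  rw [isFPL_iff] at h ⊢
  intro v hv x
  obtain ⟨a, b, c, d, hv4, hab, hac, had, hbc, hbd, hcd, h1, h2⟩ :=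
    exists_edgesAt_eq (Λ.corner 1) v
  have ha : a ∈ edgesAt v := by simp [hv4]
  have hb : b ∈ edgesAt v := by simp [hv4]
  have hc : c ∈ edgesAt v := by simp [hv4]
  have hd : d ∈ edgesAt v := by simp [hv4]
  have h1 : Λ.plaq a = Λ.plaq b := h1
  have h2 : Λ.plaq c = Λ.plaq d := h2
  have hcol : ∀ e ∈ edgesAt v, Λ.color (Λ.gyrate φ) e =
      if Λ.Alternating φ (Λ.plaq e) then Λ.color φ e else !Λ.color φ e := fun e he => by
    simp only [color, Λ.mem_edges_of_mem hv he, dif_pos]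
    rfl
  have k1 : Λ.Alternating φ (Λ.plaq a) → Λ.color φ a ≠ Λ.color φ b := fun hk =>
    hk.2 a (Λ.mem_plaq a) b (h1 ▸ Λ.mem_plaq b) v ha hb hab
  have k2 : Λ.Alternating φ (Λ.plaq c) → Λ.color φ c ≠ Λ.color φ d := fun hk =>
    hk.2 c (Λ.mem_plaq c) d (h2 ▸ Λ.mem_plaq d) v hc hd hcd
  have hold := h v hv true
  rw [hv4, card_filter_four hab hac had hbc hbd hcd] at hold ⊢
  rw [hcol a ha, hcol b hb, hcol c hc, hcol d hd, ← h1, ← h2]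
  generalize Λ.color φ a = A at *
  generalize Λ.color φ b = B at *
  generalize Λ.color φ c = C at *
  generalize Λ.color φ d = D at *
  by_cases p1 : Λ.Alternating φ (Λ.plaq a) <;> by_cases p2 : Λ.Alternating φ (Λ.plaq c) <;>
    simp only [p1, p2, if_true, if_false, forall_true_left] at k1 k2 ⊢ <;>
    clear hcol h <;> revert A B C D x <;> decide

theorem isFPLWith_gyrate {τ : Fin (2 * N) → Bool} {φ : Λ.Edge → Bool} (h : Λ.IsFPLWith τ φ) :
    Λ.IsFPLWith (complBC τ) (Λ.gyrate φ) := by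
  refine ⟨Λ.isFPL_gyrate h.1, fun k => ?_⟩
  rw [gyrate_of_not_alternating _ (Λ.not_alternating_of_isBoundary φ (Λ.isBoundary_term k)), h.2 k]
  rfl

theorem complBC_complBC (τ : Fin (2 * N) → Bool) : complBC (complBC τ) = τ := by
  funext k; simp [complBC]

theorem validTriplet_complBC {τ : Fin (2 * N) → Bool} (h : Λ.ValidTriplet τ) :
    Λ.ValidTriplet (complBC τ) := by
  have : Λ.mixedVertices (complBC τ) = Λ.mixedVertices τ := by
    ext x; simp [mixedVertices, complBC]
  exact ⟨h.1, this ▸ h.2⟩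

end LatticeDomain

/-! ### The gyration preserves the connectivity of the glued graph -/

namespace LatticeDomain

variable {N : ℕ} (Λ : LatticeDomain N)

theorem Consecutive.symm {Λ : LatticeDomain N} {φ : Λ.Edge → Bool} {e f : Λ.Edge}
    (h : Λ.Consecutive φ e f) : Λ.Consecutive φ f e :=
  ⟨h.1.symm, h.2.imp fun _ hv => ⟨hv.1, hv.2.2, hv.2.1⟩⟩

/-- The partition of the edges into monochromatic paths and cycles. -/
def pathSetoid (φ : Λ.Edge → Bool) : Setoid Λ.Edge where
  r := Λ.SamePath φ
  iseqv :=
    { refl := fun _ => Relation.ReflTransGen.refl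
      symm := fun h =>
        have : Std.Symm (Λ.Consecutive φ) := ⟨fun _ _ h => h.symm⟩
        Std.Symm.symm (r := Relation.ReflTransGen (Λ.Consecutive φ)) _ _ h
      trans := fun h h' => Relation.ReflTransGen.trans h h' }

theorem pathSetoid_of_consecutive {φ : Λ.Edge → Bool} {e f : Λ.Edge}
    (h : Λ.Consecutive φ e f) : Λ.pathSetoid φ e f :=
  Relation.ReflTransGen.single h

theorem pathSetoid_le {φ : Λ.Edge → Bool} {T : Setoid Λ.Edge}
    (h : ∀ e f, Λ.Consecutive φ e f → T e f) : Λ.pathSetoid φ ≤ T := by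
  intro e f hef
  change Relation.ReflTransGen _ e f at hef
  induction hef with
  | refl => exact T.refl e
  | tail _ h2 ih => exact T.trans ih (h _ _ h2)

/-- The partition of the edges into monochromatic paths and cycles of the glued graph, where
only pairs of black terminations are glued. -/
def gluedPathSetoid (τ : Fin (2 * N) → Bool) (φ : Λ.Edge → Bool) : Setoid Λ.Edge :=
  glueSetoid τ (Λ.pathSetoid φ) Λ.term

theorem gluedPath_of_consecutive (τ : Fin (2 * N) → Bool) {φ : Λ.Edge → Bool} {e f : Λ.Edge}
    (h : Λ.Consecutive φ e f) : Λ.gluedPathSetoid τ φ e f :=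
  le_glueSetoid _ _ _ (Λ.pathSetoid_of_consecutive h)

theorem gluedPath_pair {τ : Fin (2 * N) → Bool} (φ : Λ.Edge → Bool) {i : Fin N}
    (h : i ∈ bbPairs τ) :
    Λ.gluedPathSetoid τ φ (Λ.term (fstTerm i)) (Λ.term (sndTerm i)) :=
  glueSetoid_pair _ _ _ h

theorem isBoundary_of_mem_edgesAt {e : Λ.Edge} {v : ℤ × ℤ} (he : e.val ∈ edgesAt v)
    (hv : v ∉ Λ.verts) : Λ.IsBoundary e.val := by
  have h1 := Λ.mem_edges_iff.1 e.2
  rw [mem_edgesAt] at he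
  unfold IsBoundary
  rcases he with rfl | rfl <;> tauto

section Transfer

variable {Λ} {τ : Fin (2 * N) → Bool} {φ : Λ.Edge → Bool}

/-- Two adjacent white edges of a non-alternating plaquette. -/
theorem gluedPath_gyrate_of_adjacent (hφ : Λ.IsFPLWith τ φ) {e f : Λ.Edge}
    (hef : Λ.plaq e.val = Λ.plaq f.val) (hk : ¬ Λ.Alternating φ (Λ.plaq e.val))
    (he : φ e = false) (hf : φ f = false) {v : ℤ × ℤ} (hev : e.val ∈ edgesAt v)
    (hfv : f.val ∈ edgesAt v) :
    Λ.gluedPathSetoid (complBC τ) (Λ.gyrate φ) e f := by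
  by_cases heq : e = f
  · rw [heq]
  by_cases hv : v ∈ Λ.verts
  · refine Λ.gluedPath_of_consecutive _ ⟨?_, v, hv, hev, hfv⟩
    rw [gyrate_of_not_alternating _ hk, gyrate_of_not_alternating _ (hef ▸ hk), he, hf]
  · obtain ⟨i, h⟩ := Λ.exists_pair_of_plaq_eq (Λ.isBoundary_of_mem_edgesAt hev hv)
      (Λ.isBoundary_of_mem_edgesAt hfv hv) heq hef
    have hi : i ∈ bbPairs (complBC τ) := by
      rw [mem_bbPairs, complBC, complBC, ← hφ.2, ← hφ.2]
      rcases h with ⟨rfl, rfl⟩ | ⟨rfl, rfl⟩ <;> simp [he, hf]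
    have := Λ.gluedPath_pair (Λ.gyrate φ) hi
    rcases h with ⟨rfl, rfl⟩ | ⟨rfl, rfl⟩
    · exact this
    · exact Setoid.symm' _ this

/-- A plaquette of the gyration with four edges in the domain and terminations of different
colours is excluded by the validity of the triplet. -/
theorem not_mixed_of_four_edges (hvalid : Λ.ValidTriplet τ) (hφ : Λ.IsFPLWith τ φ)
    {e f g h : Λ.Edge} (hp : plaquetteEdges (Λ.plaq e.val) = {e.val, f.val, g.val, h.val})
    (hef : e ≠ f) (heg : e ≠ g) (heh : e ≠ h) (hfg : f ≠ g) (hfh : f ≠ h) (hgh : g ≠ h)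
    {x y : Λ.Edge} (hx : x.val ∈ plaquetteEdges (Λ.plaq e.val))
    (hy : y.val ∈ plaquetteEdges (Λ.plaq e.val)) {v : ℤ × ℤ} (hv : v ∉ Λ.verts)
    (hxv : x.val ∈ edgesAt v) (hyv : y.val ∈ edgesAt v) : φ x = φ y := by
  by_contra hxy
  obtain ⟨i, hi⟩ := Λ.exists_pair_of_plaq_eq (Λ.isBoundary_of_mem_edgesAt hxv hv)
    (Λ.isBoundary_of_mem_edgesAt hyv hv) (fun h => hxy (h ▸ rfl))
    ((Λ.plaq_eq_of_mem hx).trans (Λ.plaq_eq_of_mem hy).symm)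
  have hmem : ∀ z : Λ.Edge, z ∈ Λ.cycleAt (Λ.plaq e.val) ↔ z.val ∈ plaquetteEdges (Λ.plaq e.val) :=
    fun z => by simp [cycleAt]
  have hsub : ({e, f, g, h} : Finset Λ.Edge) ⊆ Λ.cycleAt (Λ.plaq e.val) := by
    intro z hz
    rw [hmem, hp]
    simp only [Finset.mem_insert, Finset.mem_singleton] at hz ⊢
    exact hz.imp (congrArg _) (Or.imp (congrArg _) (Or.imp (congrArg _) (congrArg _)))
  have hcard : ({e, f, g, h} : Finset Λ.Edge).card = 4 := by
    rw [Finset.card_insert_of_notMem (by simp [hef, heg, heh]),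
      Finset.card_insert_of_notMem (by simp [hfg, hfh]),
      Finset.card_insert_of_notMem (by simp [hgh]), Finset.card_singleton]
  have h4 := Finset.card_le_card hsub
  have h3 := hvalid.2 (Λ.cycleAt (Λ.plaq e.val))
    ⟨⟨x, (hmem x).2 hx⟩, Λ.plaq e.val, Λ.sameParity_plaq e.val, rfl⟩ (.inr i)
    ⟨i, rfl, by
      rw [← hφ.2, ← hφ.2]
      rcases hi with ⟨rfl, rfl⟩ | ⟨rfl, rfl⟩
      · exact hxy
      · exact Ne.symm hxy⟩
    ⟨x, (hmem x).2 hx, by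
      rcases hi with ⟨rfl, rfl⟩ | ⟨rfl, rfl⟩
      · exact Or.inl rfl
      · exact Or.inr rfl⟩
  omega

/-- The white edges of a non-alternating plaquette form a single black path after the gyration. -/
theorem gluedPath_gyrate_of_plaq_eq (hvalid : Λ.ValidTriplet τ) (hφ : Λ.IsFPLWith τ φ)
    {e f : Λ.Edge} (hef : Λ.plaq e.val = Λ.plaq f.val)
    (hk : ¬ Λ.Alternating φ (Λ.plaq e.val)) (he : φ e = false) (hf : φ f = false) :
    Λ.gluedPathSetoid (complBC τ) (Λ.gyrate φ) e f := by
  by_cases heq : e = f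
  · rw [heq]
  have hmf : f.val ∈ plaquetteEdges (Λ.plaq e.val) := hef ▸ Λ.mem_plaq f.val
  rcases adjacent_or_opposite (Λ.mem_plaq e.val) hmf (fun h => heq (Subtype.ext h)) with
    ⟨v, hev, hfv⟩ | ⟨g, h, u₁, u₂, u₃, u₄, hp, neg, neh, nfg, nfh, ngh, ee, ff, gg, hh,
      n12, n13, n14, n23, n24, n34⟩
  · exact gluedPath_gyrate_of_adjacent hφ hef hk he hf hev hfv
  have hgp : g ∈ plaquetteEdges (Λ.plaq e.val) := by simp [hp]
  have hhp : h ∈ plaquetteEdges (Λ.plaq e.val) := by simp [hp]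
  -- A side `g` between the opposite white edges `e` and `f` joins them if it is white. If it is
  -- missing from the domain, both its ends are outside the region, so `e` and `f` are the
  -- terminations of a white pair, which is glued for `complBC τ`. Only a black side in the domain
  -- fails to connect them.
  have key : ∀ (g : LatticeEdge) (u v : ℤ × ℤ), g ∈ plaquetteEdges (Λ.plaq e.val) →
      (∀ w, g ∈ edgesAt w ↔ w = u ∨ w = v) → e.val ∈ edgesAt u → f.val ∈ edgesAt v →
      (∃ hg : g ∈ Λ.verts.biUnion edgesAt, φ ⟨g, hg⟩ = true) ∨
        Λ.gluedPathSetoid (complBC τ) (Λ.gyrate φ) e f := by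
    intro g u v hgp hg hu hv
    by_cases hgm : g ∈ Λ.verts.biUnion edgesAt
    · rcases Bool.eq_false_or_eq_true (φ ⟨g, hgm⟩) with h1 | h1
      · exact Or.inl ⟨hgm, h1⟩
      · have hpg : Λ.plaq e.val = Λ.plaq g := (Λ.plaq_eq_of_mem hgp).symm
        refine Or.inr (Setoid.trans' _
          (gluedPath_gyrate_of_adjacent (f := ⟨g, hgm⟩) hφ hpg hk he h1 hu ((hg u).2 (Or.inl rfl)))
          (gluedPath_gyrate_of_adjacent (e := ⟨g, hgm⟩) hφ (hpg.symm.trans hef) (hpg ▸ hk) h1 hf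
            ((hg v).2 (Or.inr rfl)) hv))
    · right
      have hu' : u ∉ Λ.verts := fun h => hgm (Λ.mem_edges_of_mem h ((hg u).2 (Or.inl rfl)))
      have hv' : v ∉ Λ.verts := fun h => hgm (Λ.mem_edges_of_mem h ((hg v).2 (Or.inr rfl)))
      obtain ⟨i, h⟩ := Λ.exists_pair_of_plaq_eq (Λ.isBoundary_of_mem_edgesAt hu hu')
        (Λ.isBoundary_of_mem_edgesAt hv hv') heq hef
      have hi : i ∈ bbPairs (complBC τ) := by
        rw [mem_bbPairs, complBC, complBC, ← hφ.2, ← hφ.2]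
        rcases h with ⟨rfl, rfl⟩ | ⟨rfl, rfl⟩ <;> simp [he, hf]
      have := Λ.gluedPath_pair (Λ.gyrate φ) hi
      rcases h with ⟨rfl, rfl⟩ | ⟨rfl, rfl⟩
      · exact this
      · exact Setoid.symm' _ this
  rcases key g u₁ u₂ hgp gg ((ee _).2 (Or.inl rfl)) ((ff _).2 (Or.inl rfl)) with ⟨hgm, hg⟩ | h1
  swap
  · exact h1
  rcases key h u₃ u₄ hhp hh ((ee _).2 (Or.inr rfl)) ((ff _).2 (Or.inr rfl)) with ⟨hhm, hh'⟩ | h1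
  swap
  · exact h1
  exfalso
  -- Both sides are now black edges of the domain, so the cycle has length four, and validity
  -- forbids a mixed glued vertex on it. A corner outside the region would be one, since a white and
  -- a black edge meet there.
  have four : ∀ {x y : Λ.Edge}, x.val ∈ plaquetteEdges (Λ.plaq e.val) →
      y.val ∈ plaquetteEdges (Λ.plaq e.val) → ∀ {v : ℤ × ℤ}, v ∉ Λ.verts →
      x.val ∈ edgesAt v → y.val ∈ edgesAt v → φ x = φ y :=
    fun hx hy _ => not_mixed_of_four_edges (g := ⟨g, hgm⟩) (h := ⟨h, hhm⟩) hvalid hφ hp heq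
      (fun h => neg (congrArg Subtype.val h)) (fun h => neh (congrArg Subtype.val h))
      (fun h => nfg (congrArg Subtype.val h)) (fun h => nfh (congrArg Subtype.val h))
      (fun h => ngh (congrArg Subtype.val h)) hx hy
  have hem := Λ.mem_plaq e.val
  have c1 : u₁ ∈ Λ.verts := by
    by_contra hu
    have := four (x := e) (y := ⟨g, hgm⟩) hem hgp hu ((ee _).2 (Or.inl rfl)) ((gg _).2 (Or.inl rfl))
    rw [he, hg] at this; cases this
  have c2 : u₂ ∈ Λ.verts := by
    by_contra hu
    have := four (x := f) (y := ⟨g, hgm⟩) hmf hgp hu ((ff _).2 (Or.inl rfl)) ((gg _).2 (Or.inr rfl))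
    rw [hf, hg] at this; cases this
  have c3 : u₃ ∈ Λ.verts := by
    by_contra hu
    have := four (x := e) (y := ⟨h, hhm⟩) hem hhp hu ((ee _).2 (Or.inr rfl)) ((hh _).2 (Or.inl rfl))
    rw [he, hh'] at this; cases this
  have c4 : u₄ ∈ Λ.verts := by
    by_contra hu
    have := four (x := f) (y := ⟨h, hhm⟩) hmf hhp hu ((ff _).2 (Or.inr rfl)) ((hh _).2 (Or.inr rfl))
    rw [hf, hh'] at this; cases this
  -- With all corners in the region and the opposite edges of equal colour, the plaquette would be
  -- alternating.
  refine hk ⟨fun x hx => ?_, fun x hx y hy v hxv hyv hxy => ?_⟩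
  · have hall : ∀ w, x ∈ edgesAt w → w ∈ Λ.verts := by
      intro w hw
      rw [hp] at hx
      simp only [Finset.mem_insert, Finset.mem_singleton] at hx
      rcases hx with rfl | rfl | rfl | rfl
      · rcases (ee w).1 hw with rfl | rfl <;> assumption
      · rcases (ff w).1 hw with rfl | rfl <;> assumption
      · rcases (gg w).1 hw with rfl | rfl <;> assumption
      · rcases (hh w).1 hw with rfl | rfl <;> assumption
    exact ⟨hall _ (mem_edgesAt.2 (Or.inl rfl)), hall _ (mem_edgesAt.2 (Or.inr rfl))⟩
  · have ce : Λ.color φ e.val = false := (Λ.color_val φ e).trans he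
    have cf : Λ.color φ f.val = false := (Λ.color_val φ f).trans hf
    have cg : Λ.color φ g = true := (Λ.color_val φ ⟨g, hgm⟩).trans hg
    have ch : Λ.color φ h = true := (Λ.color_val φ ⟨h, hhm⟩).trans hh'
    have nef : e.val ∈ edgesAt v → f.val ∈ edgesAt v → False := by
      rw [ee, ff]
      rintro (h1 | h1) (h2 | h2)
      exacts [n12 (h1.symm.trans h2), n14 (h1.symm.trans h2), n23 (h2.symm.trans h1),
        n34 (h1.symm.trans h2)]
    have ngh : g ∈ edgesAt v → h ∈ edgesAt v → False := by
      rw [gg, hh]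
      rintro (h1 | h1) (h2 | h2)
      exacts [n13 (h1.symm.trans h2), n14 (h1.symm.trans h2), n23 (h1.symm.trans h2),
        n24 (h1.symm.trans h2)]
    rw [hp] at hx hy
    simp only [Finset.mem_insert, Finset.mem_singleton] at hx hy
    rcases hx with rfl | rfl | rfl | rfl <;> rcases hy with rfl | rfl | rfl | rfl <;>
      first
      | exact absurd rfl hxy
      | exact (nef hxv hyv).elim
      | exact (nef hyv hxv).elim
      | exact (ngh hxv hyv).elim
      | exact (ngh hyv hxv).elim
      | simp [ce, cf, cg, ch]

/-! ### Following a black path through the gyration -/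

/-- The black edges of `gyrate φ` that replace a black edge `e` of `φ`. -/
def Replaces (φ : Λ.Edge → Bool) (e e' : Λ.Edge) : Prop :=
  (Λ.Alternating φ (Λ.plaq e.val) ∧ e' = e) ∨
    (¬ Λ.Alternating φ (Λ.plaq e.val) ∧ Λ.plaq e'.val = Λ.plaq e.val ∧ φ e' = false)

/-- The choice of a replacement does not matter: around a non-alternating plaquette all candidates
lie on one glued path. -/
theorem gluedPath_of_replaces (hvalid : Λ.ValidTriplet τ) (hφ : Λ.IsFPLWith τ φ)
    {e e' e'' : Λ.Edge} (h' : Replaces φ e e') (h'' : Replaces φ e e'') :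
    Λ.gluedPathSetoid (complBC τ) (Λ.gyrate φ) e' e'' := by
  rcases h' with ⟨h1, rfl⟩ | ⟨h1, h2, h3⟩ <;> rcases h'' with ⟨k1, rfl⟩ | ⟨k1, k2, k3⟩
  · exact Setoid.refl' _ _
  · exact absurd h1 k1
  · exact absurd k1 h1
  · exact gluedPath_gyrate_of_plaq_eq hvalid hφ (h2.trans k2.symm) (h2 ▸ h1) h3 k3

theorem gyrate_eq_true_of_replaces {e e' : Λ.Edge} (h : Replaces φ e e') (he : φ e = true) :
    Λ.gyrate φ e' = true := by
  rcases h with ⟨h1, rfl⟩ | ⟨h1, h2, h3⟩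
  · rw [gyrate_of_alternating _ h1, he]
  · rw [gyrate_of_not_alternating _ (h2 ▸ h1), h3]; rfl

/-- Two black edges at a vertex are the only ones. -/
theorem eq_false_of_black_pair (hφ : Λ.IsFPL φ) {v : ℤ × ℤ} (hv : v ∈ Λ.verts) {e f g : Λ.Edge}
    (he : e.val ∈ edgesAt v) (hf : f.val ∈ edgesAt v) (hg : g.val ∈ edgesAt v) (hef : e ≠ f)
    (hge : g ≠ e) (hgf : g ≠ f) (he1 : φ e = true) (hf1 : φ f = true) : φ g = false := by
  by_contra hg1
  rw [Bool.not_eq_false] at hg1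
  have hsub : ({e, f, g} : Finset Λ.Edge) ⊆
      Finset.univ.filter fun e : Λ.Edge => e.val ∈ edgesAt v ∧ φ e = true := by
    intro z hz
    simp only [Finset.mem_insert, Finset.mem_singleton] at hz
    rw [Finset.mem_filter]
    rcases hz with rfl | rfl | rfl
    · exact ⟨Finset.mem_univ _, he, he1⟩
    · exact ⟨Finset.mem_univ _, hf, hf1⟩
    · exact ⟨Finset.mem_univ _, hg, hg1⟩
  have h1 := Finset.card_le_card hsub
  rw [hφ v hv true, Finset.card_insert_of_notMem (by simp [hef, hge.symm]),
    Finset.card_insert_of_notMem (by simp [hgf.symm]), Finset.card_singleton] at h1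
  omega

/-- If the plaquette of `e` is not alternating, the other edge of this plaquette at `v` is neither
`e` nor `f`. These two already are the black edges at `v`, so it is white and replaces `e`. -/
theorem exists_replaces_of_portal (hφ : Λ.IsFPL φ) {v : ℤ × ℤ} (hv : v ∈ Λ.verts) {e f : Λ.Edge}
    (he : e.val ∈ edgesAt v) (hf : f.val ∈ edgesAt v) (he1 : φ e = true) (hf1 : φ f = true)
    (hp : Λ.plaq e.val ≠ Λ.plaq f.val) : ∃ e', Replaces φ e e' ∧ e'.val ∈ edgesAt v := by
  by_cases hk : Λ.Alternating φ (Λ.plaq e.val)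
  · exact ⟨e, Or.inl ⟨hk, rfl⟩, he⟩
  · obtain ⟨g, hg, hge, hgp⟩ := exists_partner_edge (Λ.corner 1) he
    change Λ.plaq g = Λ.plaq e.val at hgp
    refine ⟨⟨g, Λ.mem_edges_of_mem hv hg⟩, Or.inr ⟨hk, hgp, ?_⟩, hg⟩
    refine eq_false_of_black_pair hφ hv he hf hg (fun h => hp (h ▸ rfl))
      (fun h => hge (congrArg Subtype.val h)) (fun h => hp ?_) he1 hf1
    rw [← hgp, ← congrArg Subtype.val h]

/-- The glued black paths of `gyrate φ` attached to a black edge of `φ`. -/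
def attached (τ : Fin (2 * N) → Bool) (φ : Λ.Edge → Bool) (e : Λ.Edge) : Set Λ.Edge :=
  {x | φ e = true ∧ ∃ e', Replaces φ e e' ∧ Λ.gluedPathSetoid (complBC τ) (Λ.gyrate φ) x e'}

/-- Inside a non-alternating plaquette the two edges have the same replacements; inside an
alternating one they coincide, having equal colours. When the path changes plaquette at `v`, both
edges have a replacement at `v`, and these two meet there. -/
theorem attached_subset_of_consecutive (hvalid : Λ.ValidTriplet τ) (hφ : Λ.IsFPLWith τ φ)
    {e f : Λ.Edge} (h : Λ.Consecutive φ e f) : attached τ φ e ⊆ attached τ φ f := by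
  rintro x ⟨he1, e', he', hx⟩
  obtain ⟨hcol, v, hv, he, hf⟩ := h
  have hf1 := hcol ▸ he1
  refine ⟨hf1, ?_⟩
  by_cases hp : Λ.plaq e.val = Λ.plaq f.val
  · rcases he' with ⟨h1, rfl⟩ | ⟨h1, h2, h3⟩
    · have : e' = f := by
        by_contra hne
        have := h1.2 e'.val (Λ.mem_plaq _) f.val (hp ▸ Λ.mem_plaq _) v he hf
          (fun h => hne (Subtype.ext h))
        rw [color_val, color_val] at this
        exact this hcol
      exact ⟨e', Or.inl ⟨hp ▸ h1, this⟩, hx⟩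
    · exact ⟨e', Or.inr ⟨hp ▸ h1, h2.trans hp, h3⟩, hx⟩
  · obtain ⟨a, ha, hav⟩ := exists_replaces_of_portal hφ.1 hv he hf he1 hf1 hp
    obtain ⟨b, hb, hbv⟩ := exists_replaces_of_portal hφ.1 hv hf he hf1 he1 (Ne.symm hp)
    refine ⟨b, hb, Setoid.trans' _ hx (Setoid.trans' _ (gluedPath_of_replaces hvalid hφ he' ha) ?_)⟩
    refine Λ.gluedPath_of_consecutive _ ⟨?_, v, hv, hav, hbv⟩
    rw [gyrate_eq_true_of_replaces ha he1, gyrate_eq_true_of_replaces hb hf1]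

theorem attached_subset_of_boundary {e f : Λ.Edge} (he : Λ.IsBoundary e.val)
    (h : Λ.plaq e.val = Λ.plaq f.val) (hf1 : φ f = true) : attached τ φ e ⊆ attached τ φ f := by
  rintro x ⟨-, e', he', hx⟩
  have hk := Λ.not_alternating_of_isBoundary φ he
  rcases he' with ⟨h1, rfl⟩ | ⟨h1, h2, h3⟩
  · exact absurd h1 hk
  · exact ⟨hf1, e', Or.inr ⟨h ▸ hk, h2.trans h, h3⟩, hx⟩

/-- By the universal property of `glueSetoid`, invariance of `attached` need only be checked on
consecutive edges and on glued pairs. -/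
theorem gluedPathSetoid_le_ker_attached (hvalid : Λ.ValidTriplet τ) (hφ : Λ.IsFPLWith τ φ) :
    Λ.gluedPathSetoid τ φ ≤ Setoid.ker (attached τ φ) := by
  refine glueSetoid_le τ (Λ.pathSetoid_le fun e f h => ?_) fun i hi => ?_
  · exact (attached_subset_of_consecutive hvalid hφ h).antisymm
      (attached_subset_of_consecutive hvalid hφ h.symm)
  · have hi' := (mem_bbPairs τ).1 hi
    rw [← hφ.2, ← hφ.2] at hi'
    have hp := (Λ.plaq_fstTerm i).trans (Λ.plaq_sndTerm i).symm
    exact (attached_subset_of_boundary (Λ.isBoundary_term _) hp hi'.2).antisymm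
      (attached_subset_of_boundary (Λ.isBoundary_term _) hp.symm hi'.1)

/-- The black termination for `complBC τ` is the white one for `τ`, in the same plaquette, which is
not alternating because it has a boundary edge. -/
theorem replaces_pairBlack (hφ : Λ.IsFPLWith τ φ) {i : Fin N} (hi : i ∈ mixedPairs τ) :
    φ (Λ.term (pairBlack τ i)) = true ∧
      Replaces φ (Λ.term (pairBlack τ i)) (Λ.term (pairBlack (complBC τ) i)) := by
  rw [mem_mixedPairs] at hi
  have hp := (Λ.plaq_fstTerm i).trans (Λ.plaq_sndTerm i).symm
  have h1 := Λ.not_alternating_of_isBoundary φ (Λ.isBoundary_term (fstTerm i))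
  have h2 := Λ.not_alternating_of_isBoundary φ (Λ.isBoundary_term (sndTerm i))
  unfold pairBlack complBC
  cases h3 : τ (fstTerm i) <;> cases h4 : τ (sndTerm i)
  · simp [h3, h4] at hi
  · simp only [Bool.false_eq_true, if_false, Bool.not_false, if_true]
    exact ⟨(hφ.2 _).trans h4, Or.inr ⟨h2, hp, (hφ.2 _).trans h3⟩⟩
  · simp only [if_true, Bool.not_true, Bool.false_eq_true, if_false]
    exact ⟨(hφ.2 _).trans h3, Or.inr ⟨h1, hp.symm, (hφ.2 _).trans h4⟩⟩
  · simp [h3, h4] at hi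

/-- The gyration preserves the connectivity of the mixed pairs in the glued graph. -/
theorem gluedPath_gyrate (hvalid : Λ.ValidTriplet τ) (hφ : Λ.IsFPLWith τ φ) {i j : Fin N}
    (hi : i ∈ mixedPairs τ) (hj : j ∈ mixedPairs τ)
    (h : Λ.gluedPathSetoid τ φ (Λ.term (pairBlack τ i)) (Λ.term (pairBlack τ j))) :
    Λ.gluedPathSetoid (complBC τ) (Λ.gyrate φ) (Λ.term (pairBlack (complBC τ) i))
      (Λ.term (pairBlack (complBC τ) j)) := by
  have hi' := replaces_pairBlack hφ hi
  have hj' := replaces_pairBlack hφ hj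
  have h1 : Λ.term (pairBlack (complBC τ) i) ∈ attached τ φ (Λ.term (pairBlack τ i)) :=
    ⟨hi'.1, _, hi'.2, Setoid.refl' _ _⟩
  have h2 := gluedPathSetoid_le_ker_attached hvalid hφ h
  rw [Setoid.ker_def] at h2
  rw [h2] at h1
  obtain ⟨-, e', he', hx⟩ := h1
  exact Setoid.trans' _ hx (gluedPath_of_replaces hvalid hφ he' hj'.2)

/-- The converse is the direct implication for `gyrate φ` and `complBC τ`: validity is symmetric and
both operations are involutions. -/
theorem gluedPath_gyrate_iff (hvalid : Λ.ValidTriplet τ) (hφ : Λ.IsFPLWith τ φ) {i j : Fin N}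
    (hi : i ∈ mixedPairs τ) (hj : j ∈ mixedPairs τ) :
    Λ.gluedPathSetoid τ φ (Λ.term (pairBlack τ i)) (Λ.term (pairBlack τ j)) ↔
    Λ.gluedPathSetoid (complBC τ) (Λ.gyrate φ) (Λ.term (pairBlack (complBC τ) i))
      (Λ.term (pairBlack (complBC τ) j)) := by
  refine ⟨gluedPath_gyrate hvalid hφ hi hj, fun h => ?_⟩
  have := gluedPath_gyrate (Λ.validTriplet_complBC hvalid) (Λ.isFPLWith_gyrate hφ)
    (mixedPairs_complBC τ ▸ hi) (mixedPairs_complBC τ ▸ hj) h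
  rwa [complBC_complBC, gyrate_gyrate] at this

end Transfer

end LatticeDomain

/-! ### Monochromatic paths have two ends -/

theorem LatticeEdge.src_ne_tgt (e : LatticeEdge) : e.src ≠ e.tgt := by
  cases e <;> simp [LatticeEdge.src, LatticeEdge.tgt]

namespace LatticeDomain

variable {N : ℕ} {Λ : LatticeDomain N} {φ : Λ.Edge → Bool}

theorem SamePath.color_eq {e f : Λ.Edge} (h : Λ.SamePath φ e f) : φ e = φ f := by
  induction h with
  | refl => rfl
  | tail _ h2 ih => exact ih.trans h2.1

open Classical in
/-- The edges of the path or cycle that contains `e`. -/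
noncomputable def component (φ : Λ.Edge → Bool) (e : Λ.Edge) : Finset Λ.Edge :=
  Finset.univ.filter fun f => Λ.SamePath φ e f

theorem mem_component {e f : Λ.Edge} : f ∈ component φ e ↔ Λ.SamePath φ e f := by
  simp [component]

open Classical in
/-- The vertices of the path or cycle that contains `e`. -/
noncomputable def componentVerts (φ : Λ.Edge → Bool) (e : Λ.Edge) : Finset (ℤ × ℤ) :=
  Λ.verts.filter fun v => ∃ f ∈ component φ e, f.val ∈ edgesAt v

/-- Edges of the same colour at a common vertex lie on the same path, so the component contains both
edges of its colour at `v`. -/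
theorem card_component_at (hφ : Λ.IsFPL φ) {e : Λ.Edge} {v : ℤ × ℤ}
    (hv : v ∈ componentVerts φ e) :
    ((component φ e).filter fun f => f.val ∈ edgesAt v).card = 2 := by
  classical
  obtain ⟨hv, f, hf, hfv⟩ := Finset.mem_filter.1 hv
  rw [mem_component] at hf
  rw [← hφ v hv (φ e)]
  congr 1
  ext g
  simp only [Finset.mem_filter, Finset.mem_univ, true_and, mem_component]
  constructor
  · rintro ⟨h1, h2⟩
    exact ⟨h2, h1.color_eq.symm⟩
  · rintro ⟨h1, h2⟩
    exact ⟨hf.tail ⟨hf.color_eq.symm.trans h2.symm, v, hv, hfv, h1⟩, h1⟩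

open Classical in
-- `componentVerts` keeps only vertices of the region: an interior edge has two such ends, a
-- boundary edge one.
theorem card_componentVerts_at {e f : Λ.Edge} (hf : f ∈ component φ e) :
    ((componentVerts φ e).filter fun v => f.val ∈ edgesAt v).card +
      (if Λ.IsBoundary f.val then 1 else 0) = 2 := by
  have h1 : (componentVerts φ e).filter (fun v => f.val ∈ edgesAt v) =
      ({f.val.src, f.val.tgt} : Finset (ℤ × ℤ)).filter fun v => v ∈ Λ.verts := by
    ext v
    simp only [componentVerts, Finset.mem_filter, Finset.mem_insert, Finset.mem_singleton]
    constructor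
    · rintro ⟨⟨h1, -⟩, h2⟩
      rw [mem_edgesAt] at h2
      exact ⟨h2.imp Eq.symm Eq.symm, h1⟩
    · rintro ⟨h1, h2⟩
      have : f.val ∈ edgesAt v := mem_edgesAt.2 (h1.imp Eq.symm Eq.symm)
      exact ⟨⟨h2, f, hf, this⟩, this⟩
  have h2 := Λ.mem_edges_iff.1 f.2
  rw [h1, Finset.card_filter, Finset.sum_insert (by simp [LatticeEdge.src_ne_tgt]),
    Finset.sum_singleton]
  unfold IsBoundary
  by_cases h3 : f.val.src ∈ Λ.verts <;> by_cases h4 : f.val.tgt ∈ Λ.verts <;> simp_all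

open Classical in
theorem two_mul_card_componentVerts (hφ : Λ.IsFPL φ) (e : Λ.Edge) :
    2 * (componentVerts φ e).card + ((component φ e).filter fun f => Λ.IsBoundary f.val).card =
      2 * (component φ e).card := by
  have h1 := Finset.sum_card_bipartiteAbove_eq_sum_card_bipartiteBelow
    (s := component φ e) (t := componentVerts φ e) fun f v => f.val ∈ edgesAt v
  have h2 : ∑ v ∈ componentVerts φ e,
      ((component φ e).filter fun f => f.val ∈ edgesAt v).card = 2 * (componentVerts φ e).card := by
    rw [Finset.sum_congr rfl fun v hv => card_component_at hφ hv]
    simp [mul_comm]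
  have h3 : ∑ f ∈ component φ e, (((componentVerts φ e).filter fun v => f.val ∈ edgesAt v).card +
      (if Λ.IsBoundary f.val then 1 else 0)) = 2 * (component φ e).card := by
    rw [Finset.sum_congr rfl fun f hf => card_componentVerts_at hf]
    simp [mul_comm]
  rw [Finset.sum_add_distrib, ← Finset.card_filter] at h3
  simp only [Finset.bipartiteAbove, Finset.bipartiteBelow] at h1
  omega

/-- The graph of the edges of a path or cycle, that are adjacent if they share a vertex. -/
def componentGraph (φ : Λ.Edge → Bool) (e : Λ.Edge) : SimpleGraph (component φ e) where
  Adj f g := f ≠ g ∧ ∃ v ∈ Λ.verts, f.val.val ∈ edgesAt v ∧ g.val.val ∈ edgesAt v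
  symm := ⟨fun _ _ h => ⟨h.1.symm, h.2.imp fun _ hv => ⟨hv.1, hv.2.2, hv.2.1⟩⟩⟩
  loopless := ⟨fun _ h => h.1 rfl⟩

theorem componentGraph_connected (φ : Λ.Edge → Bool) (e : Λ.Edge) :
    (componentGraph φ e).Connected := by
  have he : e ∈ component φ e := mem_component.2 Relation.ReflTransGen.refl
  have key : ∀ f (hf : f ∈ component φ e), (componentGraph φ e).Reachable ⟨e, he⟩ ⟨f, hf⟩ := by
    intro f hf
    have h := mem_component.1 hf
    change Relation.ReflTransGen _ e f at h
    induction h with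
    | refl => rfl
    | @tail f g h1 h2 ih =>
      refine (ih (mem_component.2 h1)).trans ?_
      by_cases hfg : f = g
      · subst hfg; rfl
      · exact SimpleGraph.Adj.reachable ⟨fun h => hfg (congrArg Subtype.val h), h2.2⟩
  have : Nonempty (component φ e) := ⟨⟨e, he⟩⟩
  exact ⟨fun f g => (key f.1 f.2).symm.trans (key g.1 g.2)⟩

/-- Only two edges of the component meet at a vertex, so an adjacency is determined by a vertex that
its two edges share. -/
theorem card_edgeSet_componentGraph_le (hφ : Λ.IsFPL φ) (e : Λ.Edge) :
    Nat.card (componentGraph φ e).edgeSet ≤ (componentVerts φ e).card := by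
  classical
  have key : ∀ z : (componentGraph φ e).edgeSet, ∃ v : componentVerts φ e,
      ∀ f ∈ z.val, f.val.val ∈ edgesAt v.val := by
    rintro ⟨z, hz⟩
    induction z using Sym2.ind with
    | _ f g =>
      obtain ⟨-, v, hv, hf, hg⟩ := hz
      refine ⟨⟨v, Finset.mem_filter.2 ⟨hv, f.val, f.2, hf⟩⟩, fun h hh => ?_⟩
      rcases Sym2.mem_iff.1 hh with rfl | rfl
      · exact hf
      · exact hg
  choose V hV using key
  have hinj : Function.Injective V := by
    rintro ⟨z, hz⟩ ⟨z', hz'⟩ hzz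
    have h1 := hV ⟨z, hz⟩
    have h2 := hV ⟨z', hz'⟩
    rw [← hzz] at h2
    generalize V ⟨z, hz⟩ = v at h1 h2
    have hcard := card_component_at hφ v.2
    obtain ⟨a, b, hab, hA⟩ := Finset.card_eq_two.1 hcard
    have hmem : ∀ f : component φ e, f.val.val ∈ edgesAt v.val → f.val = a ∨ f.val = b := by
      intro f hf
      have : f.val ∈ (component φ e).filter fun f => f.val ∈ edgesAt v.val :=
        Finset.mem_filter.2 ⟨f.2, hf⟩
      simpa [hA] using this
    induction z using Sym2.ind with
    | _ f g =>
      induction z' using Sym2.ind with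
      | _ f' g' =>
        have n1 : f.val ≠ g.val := fun h => hz.1 (Subtype.ext h)
        have n2 : f'.val ≠ g'.val := fun h => hz'.1 (Subtype.ext h)
        have c1 := hmem f (h1 f (by simp))
        have c2 := hmem g (h1 g (by simp))
        have c3 := hmem f' (h2 f' (by simp))
        have c4 := hmem g' (h2 g' (by simp))
        refine Subtype.ext ?_
        change s(f, g) = s(f', g')
        rw [Sym2.eq_iff, Subtype.ext_iff, Subtype.ext_iff, Subtype.ext_iff, Subtype.ext_iff]
        grind
  have := Nat.card_le_card_of_injective V hinj
  rwa [Nat.card_eq_fintype_card (α := componentVerts φ e), Fintype.card_coe] at this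

open Classical in
-- With `V` vertices, `E` edges and `B` boundary edges, incidences give `2V + B = 2E` and
-- connectedness gives `E ≤ V + 1`. So `B` is even, positive and at most 2.
theorem card_boundary_component (hφ : Λ.IsFPL φ) (e : Λ.Edge) (he : Λ.IsBoundary e.val) :
    ((component φ e).filter fun f => Λ.IsBoundary f.val).card = 2 := by
  have h1 := two_mul_card_componentVerts hφ e
  have h2 := (componentGraph_connected φ e).card_vert_le_card_edgeSet_add_one
  have h3 := card_edgeSet_componentGraph_le hφ e
  rw [Nat.card_eq_fintype_card, Fintype.card_coe] at h2
  have h4 : 0 < ((component φ e).filter fun f => Λ.IsBoundary f.val).card :=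
    Finset.card_pos.2 ⟨e, Finset.mem_filter.2 ⟨mem_component.2 Relation.ReflTransGen.refl, he⟩⟩
  omega

/-- The path that starts at a termination has exactly one other end. -/
theorem exists_other_end (hφ : Λ.IsFPL φ) (k : Fin (2 * N)) :
    ∃ l, l ≠ k ∧ ∀ r, Λ.SamePath φ (Λ.term k) (Λ.term r) ↔ r = k ∨ r = l := by
  classical
  have h := card_boundary_component hφ (Λ.term k) (Λ.isBoundary_term k)
  have hmem : ∀ r, Λ.term r ∈ (component φ (Λ.term k)).filter (fun f => Λ.IsBoundary f.val) ↔
      Λ.SamePath φ (Λ.term k) (Λ.term r) := fun r => by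
    rw [Finset.mem_filter, mem_component]
    exact and_iff_left (Λ.isBoundary_term r)
  have hk := (hmem k).2 Relation.ReflTransGen.refl
  obtain ⟨f, hf, hfk⟩ := Finset.exists_mem_ne (one_lt_two.trans_eq h.symm) (Λ.term k)
  obtain ⟨l, hl⟩ := Λ.exists_term_eq (Finset.mem_filter.1 hf).2
  obtain rfl : Λ.term l = f := Subtype.ext hl
  refine ⟨l, fun h => hfk (h ▸ rfl), fun r => ?_⟩
  have hsub : ({Λ.term k, Λ.term l} : Finset Λ.Edge) ⊆
      (component φ (Λ.term k)).filter fun f => Λ.IsBoundary f.val := by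
    intro z hz
    simp only [Finset.mem_insert, Finset.mem_singleton] at hz
    rcases hz with rfl | rfl
    · exact hk
    · exact hf
  have heq := Finset.eq_of_subset_of_card_le hsub
    (by rw [h, Finset.card_insert_of_notMem (by simpa using hfk.symm), Finset.card_singleton])
  rw [← hmem, ← heq]
  simp [Λ.term_injective.eq_iff]

end LatticeDomain

/-! ### Planarity -/

theorem sum_edgesAt {M : Type*} [AddCommMonoid M] (Q : LatticeEdge → M) (x y : ℤ) :
    ∑ e ∈ edgesAt (x, y), Q e =
      Q (.horiz x y) + (Q (.horiz (x - 1) y) + (Q (.vert x y) + Q (.vert x (y - 1)))) := by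
  rw [edgesAt, Finset.sum_insert (by simp; omega), Finset.sum_insert (by simp),
    Finset.sum_insert (by simp; omega), Finset.sum_singleton]

/-- A closed `1`-cochain on the dual square lattice that vanishes on the left of a vertical line is
exact. -/
theorem exists_potential (Q : LatticeEdge → ZMod 2) (L : ℤ)
    (hL : ∀ e : LatticeEdge, e.src.1 < L → Q e = 0) (hQ : ∀ v, ∑ e ∈ edgesAt v, Q e = 0) :
    ∃ f : ℤ × ℤ → ZMod 2, ∀ e : LatticeEdge, f e.lowFace + f e.highFace = Q e := by
  have hQ' : ∀ x y, Q (.horiz x y) + Q (.horiz (x - 1) y) + Q (.vert x y) + Q (.vert x (y - 1)) =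
      0 := fun x y => by
    have := hQ (x, y)
    rw [sum_edgesAt] at this
    rw [← this]; ring
  have hsum : ∀ x y, L ≤ x → ∑ i ∈ Finset.Icc L x, Q (.vert i y) =
      ∑ i ∈ Finset.Icc L (x - 1), Q (.vert i y) + Q (.vert x y) := fun x y hx => by
    have : Finset.Icc L x = insert x (Finset.Icc L (x - 1)) := by
      ext i; simp only [Finset.mem_Icc, Finset.mem_insert]; omega
    rw [this, Finset.sum_insert (by simp), add_comm]
  have two : ∀ a b : ZMod 2, a + (a + b) = b := by decide
  have cancel : ∀ q s t a b : ZMod 2, q + (s + t) + a + b = 0 → s + b + (t + a) = q := by decide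
  -- The potential integrates `Q` along the row of `p`, starting from the far left.
  refine ⟨fun p => ∑ i ∈ Finset.Icc L p.1, Q (.vert i p.2), fun e => ?_⟩
  cases e with
  | vert x y =>
    simp only [LatticeEdge.lowFace, LatticeEdge.highFace]
    rcases lt_or_ge x L with hx | hx
    · rw [hL (.vert x y) hx, Finset.Icc_eq_empty (by omega), Finset.Icc_eq_empty (by omega)]; simp
    · rw [hsum x y hx, two]
  | horiz x y =>
    simp only [LatticeEdge.lowFace, LatticeEdge.highFace]
    rcases lt_or_ge x (L - 1) with hx | hx
    · rw [hL _ (by simp only [LatticeEdge.src]; omega), Finset.Icc_eq_empty (by omega)]; simp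
    -- At `x = L - 1` both sums are empty and `Q` vanishes; closedness at the vertex `(x + 1, y)`
    -- carries the identity one column to the right.
    · induction x, hx using Int.leInduction with
      | base =>
        rw [hL (.horiz (L - 1) y) (by simp only [LatticeEdge.src]; omega), Finset.Icc_eq_empty (by omega)]; simp
      | succ x hx ih =>
        have h := hQ' (x + 1) y
        rw [hsum (x + 1) (y - 1) (by omega), hsum (x + 1) y (by omega)]
        rw [add_sub_cancel_right] at h ⊢
        rw [← ih] at h
        exact cancel _ _ _ _ _ h

/-- The coboundary of a function on the plaquettes is closed. -/
theorem sum_coboundary_edgesAt (g : ℤ × ℤ → ZMod 2) (v : ℤ × ℤ) :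
    ∑ e ∈ edgesAt v, (g e.lowFace + g e.highFace) = 0 := by
  obtain ⟨x, y⟩ := v
  rw [sum_edgesAt]
  simp only [LatticeEdge.lowFace, LatticeEdge.highFace]
  generalize g _ = a
  generalize g _ = b
  generalize g _ = c
  generalize g _ = d
  revert a b c d
  decide

/-- A function on the plaquettes that is invariant across the edges at a vertex is constant around
this vertex. -/
theorem eq_of_invariant_around {X : Type*} {F : ℤ × ℤ → X} {v : ℤ × ℤ}
    (h : ∀ e ∈ edgesAt v, F e.lowFace = F e.highFace) {e e' : LatticeEdge} (he : e ∈ edgesAt v)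
    (he' : e' ∈ edgesAt v) : F e.lowFace = F e'.lowFace := by
  obtain ⟨x, y⟩ := v
  simp only [edgesAt, Finset.mem_insert, Finset.mem_singleton, forall_eq_or_imp, forall_eq,
    LatticeEdge.lowFace, LatticeEdge.highFace] at h he he'
  obtain ⟨h1, h2, h3, h4⟩ := h
  rcases he with rfl | rfl | rfl | rfl <;> rcases he' with rfl | rfl | rfl | rfl <;>
    simp only [LatticeEdge.lowFace] <;> grind

/-! ### Paths as cochains modulo 2, and the absence of crossings -/

namespace LatticeDomain

variable {N : ℕ} {Λ : LatticeDomain N} {φ : Λ.Edge → Bool}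

open Classical in
/-- The indicator function of the path that contains `e`. -/
noncomputable def pathIndicator (φ : Λ.Edge → Bool) (e : Λ.Edge) (f : LatticeEdge) : ZMod 2 :=
  if ∃ h : f ∈ Λ.verts.biUnion edgesAt, Λ.SamePath φ e ⟨f, h⟩ then 1 else 0

/-- A vertex of the region meets the path in zero or two edges. -/
theorem sum_pathIndicator (hφ : Λ.IsFPL φ) (e : Λ.Edge) {v : ℤ × ℤ} (hv : v ∈ Λ.verts) :
    ∑ f ∈ edgesAt v, pathIndicator φ e f = 0 := by
  classical
  have hcard : ((edgesAt v).filter fun f =>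
      ∃ h : f ∈ Λ.verts.biUnion edgesAt, Λ.SamePath φ e ⟨f, h⟩).card =
      ((component φ e).filter fun f => f.val ∈ edgesAt v).card := by
    symm
    refine Finset.card_bij (fun f _ => f.val) ?_ (fun _ _ _ _ h => Subtype.ext h) ?_
    · intro f hf
      rw [Finset.mem_filter, mem_component] at hf
      exact Finset.mem_filter.2 ⟨hf.2, f.2, hf.1⟩
    · intro f hf
      obtain ⟨h1, h2, h3⟩ := Finset.mem_filter.1 hf
      exact ⟨⟨f, h2⟩, Finset.mem_filter.2 ⟨mem_component.2 h3, h1⟩, rfl⟩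
  unfold pathIndicator
  rw [Finset.sum_boole, hcard]
  by_cases hv' : v ∈ componentVerts φ e
  · rw [card_component_at hφ hv']; rfl
  · rw [Finset.filter_false_of_mem]
    · simp
    · intro f hf hfv
      exact hv' (Finset.mem_filter.2 ⟨hv, f, hf, hfv⟩)

variable (Λ) in
open Classical in
/-- The indicator function of the corners between the terminations `i` and `j`. -/
noncomputable def cornerIndicator (i j : ℕ) (p : ℤ × ℤ) : ZMod 2 :=
  if ∃ r : ℕ, i < r ∧ r ≤ j ∧ Λ.corner (r : ZMod (2 * N)) = p then 1 else 0

open Classical in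
theorem cornerIndicator_corner {i j r : ℕ} (hj : j < 2 * N) (hr : r ≤ 2 * N) :
    Λ.cornerIndicator i j (Λ.corner (r : ZMod (2 * N))) = if i < r ∧ r ≤ j then 1 else 0 := by
  unfold cornerIndicator
  congr 1
  rw [eq_iff_iff]
  constructor
  · rintro ⟨s, h1, h2, h3⟩
    have h4 := Λ.corner_injective h3
    -- The value `r = 2 * N` wraps around to `corner 0`; neither index lies in the interval, because
    -- `j < 2 * N`.
    rcases hr.eq_or_lt with rfl | hr
    · rw [ZMod.natCast_self, ← Nat.cast_zero] at h4
      have := natCast_inj (N := N) (by omega) (by omega) h4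
      omega
    · have := natCast_inj (N := N) (by omega) hr h4
      subst this
      exact ⟨h1, h2⟩
  · rintro ⟨h1, h2⟩
    exact ⟨r, h1, h2, rfl⟩

theorem term_faces (r : Fin (2 * N)) :
    ((Λ.term r).val.lowFace = Λ.corner (r.val : ZMod (2 * N)) ∧
      (Λ.term r).val.highFace = Λ.corner ((r.val + 1 : ℕ) : ZMod (2 * N))) ∨
    ((Λ.term r).val.lowFace = Λ.corner ((r.val + 1 : ℕ) : ZMod (2 * N)) ∧
      (Λ.term r).val.highFace = Λ.corner (r.val : ZMod (2 * N))) := by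
  have := Dir.crossed_faces (Λ.corner (r.val : ZMod (2 * N))) (Λ.dir (r.val : ZMod (2 * N)))
  rw [← Λ.corner_succ, ← Nat.cast_one, ← Nat.cast_add] at this
  exact this

/-- Two paths of the same colour do not cross. -/
theorem not_crossing (hφ : Λ.IsFPL φ) {i k j l : Fin (2 * N)} (hik : i < k) (hkj : k < j)
    (hjl : j < l) (hij : Λ.SamePath φ (Λ.term i) (Λ.term j))
    (hkl : Λ.SamePath φ (Λ.term k) (Λ.term l)) (hcol : φ (Λ.term i) = φ (Λ.term k)) : False := by
  classical
  obtain ⟨i', hi', hend⟩ := exists_other_end hφ i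
  obtain rfl : j = i' := ((hend j).1 hij).resolve_left (hik.trans hkj).ne'
  have hik' : ¬ Λ.SamePath φ (Λ.term i) (Λ.term k) := fun h =>
    ((hend k).1 h).elim hik.ne' hkj.ne
  have hil' : ¬ Λ.SamePath φ (Λ.term i) (Λ.term l) := fun h =>
    ((hend l).1 h).elim ((hik.trans hkj).trans hjl).ne' hjl.ne'
  set χ := pathIndicator φ (Λ.term i) with hχ
  set g := Λ.cornerIndicator i.val j.val with hg
  have hgc : ∀ r : ℕ, r ≤ 2 * N → g (Λ.corner (r : ZMod (2 * N))) =
      if i.val < r ∧ r ≤ j.val then 1 else 0 := fun r hr => cornerIndicator_corner j.2 hr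
  have hχterm : ∀ r, χ (Λ.term r).val = if r.val = i.val ∨ r.val = j.val then 1 else 0 := fun r => by
    rw [hχ, pathIndicator]
    congr 1
    rw [eq_iff_iff, ← Fin.ext_iff, ← Fin.ext_iff, ← hend]
    exact ⟨fun ⟨_, h⟩ => h, fun h => ⟨(Λ.term r).2, h⟩⟩
  -- Along the boundary, `g` jumps exactly at the terminations `i` and `j`, the two ends of the
  -- path.
  have hbd : ∀ e, Λ.IsBoundary e → χ e + (g e.lowFace + g e.highFace) = 0 := by
    intro e he
    obtain ⟨r, rfl⟩ := Λ.exists_term_eq he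
    have h1 : g (Λ.term r).val.lowFace + g (Λ.term r).val.highFace =
        g (Λ.corner (r.val : ZMod (2 * N))) + g (Λ.corner ((r.val + 1 : ℕ) : ZMod (2 * N))) := by
      rcases Λ.term_faces r with ⟨h1, h2⟩ | ⟨h1, h2⟩ <;> rw [h1, h2]
      rw [add_comm]
    rw [h1, hχterm, hgc _ (by omega), hgc _ (by omega)]
    have h2 : i.val < j.val := hik.trans hkj
    by_cases c1 : r.val = i.val
    · have c2 : ¬ r.val = j.val := by omega
      have c3 : ¬ (i.val < r.val ∧ r.val ≤ j.val) := by omega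
      have c4 : i.val < r.val + 1 ∧ r.val + 1 ≤ j.val := by omega
      rw [if_pos (Or.inl c1), if_neg c3, if_pos c4]; rfl
    · by_cases c2 : r.val = j.val
      · have c3 : i.val < r.val ∧ r.val ≤ j.val := by omega
        have c4 : ¬ (i.val < r.val + 1 ∧ r.val + 1 ≤ j.val) := by omega
        rw [if_pos (Or.inr c2), if_pos c3, if_neg c4]; rfl
      · rw [if_neg (by tauto), zero_add]
        by_cases c3 : i.val < r.val ∧ r.val ≤ j.val
        · rw [if_pos c3, if_pos (by omega)]; rfl
        · rw [if_neg c3, if_neg (by omega)]; rfl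
  -- The sum of `χ` and the coboundary of `g` vanishes on boundary edges, so its extension by zero
  -- is closed at every vertex of the lattice, inside or outside the region.
  set Q : LatticeEdge → ZMod 2 := fun e =>
    if e.src ∈ Λ.verts ∧ e.tgt ∈ Λ.verts then χ e + (g e.lowFace + g e.highFace) else 0 with hQdef
  have hQedge : ∀ e, e ∈ Λ.verts.biUnion edgesAt →
      Q e = χ e + (g e.lowFace + g e.highFace) := fun e he => by
    by_cases h : e.src ∈ Λ.verts ∧ e.tgt ∈ Λ.verts
    · exact if_pos h
    · have h' := Λ.mem_edges_iff.1 he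
      rw [hbd e (by unfold IsBoundary; tauto)]
      exact if_neg h
  have hQbd : ∀ e, Λ.IsBoundary e → Q e = 0 := fun e he =>
    if_neg fun h => he (by simp [h.1, h.2])
  obtain ⟨L, hL⟩ : ∃ L : ℤ, ∀ v ∈ Λ.verts, L ≤ v.1 := by
    obtain ⟨L, hL⟩ := (Λ.verts.image Prod.fst).bddBelow
    exact ⟨L, fun v hv => hL (Finset.mem_coe.2 (Finset.mem_image_of_mem _ hv))⟩
  obtain ⟨f, hf⟩ := exists_potential Q L
    (fun e he => if_neg fun h => absurd (hL _ h.1) (by omega)) fun v => by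
      by_cases hv : v ∈ Λ.verts
      · rw [Finset.sum_congr rfl fun e he => hQedge e (Λ.mem_edges_of_mem hv he),
          Finset.sum_add_distrib, sum_coboundary_edgesAt, sum_pathIndicator hφ _ hv, add_zero]
      · refine Finset.sum_eq_zero fun e he => if_neg fun h => hv ?_
        rcases mem_edgesAt.1 he with rfl | rfl
        · exact h.1
        · exact h.2
  have eq_of : ∀ a b : ZMod 2, a + b = 0 → a = b := by decide
  -- On the edges of the domain the coboundary of `F` is `χ`: this function tells apart the two
  -- sides of the path from `i` to `j`.
  set F : ℤ × ℤ → ZMod 2 := fun p => f p + g p with hF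
  have hFχ : ∀ e, e ∈ Λ.verts.biUnion edgesAt → χ e = 0 → F e.lowFace = F e.highFace := by
    intro e he h0
    have h1 := hf e
    rw [hQedge e he, h0, zero_add] at h1
    revert h1
    simp only [hF]
    generalize f _ = a
    generalize f _ = b
    generalize g _ = c
    generalize g _ = d
    revert a b c d
    decide
  have hpath : ∀ e, Λ.SamePath φ (Λ.term k) e →
      F (Λ.term k).val.lowFace = F e.val.lowFace := by
    intro e he
    induction he with
    | refl => rfl
    | @tail a b h1 h2 ih =>
      obtain ⟨hab, v, hv, ha, hb⟩ := h2
      refine ih.trans (eq_of_invariant_around (v := v) (fun c hc => ?_) ha hb)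
      -- No edge of the first path meets the second one: having the same colour, the two paths would
      -- coincide.
      refine hFχ c (Λ.mem_edges_of_mem hv hc) (if_neg ?_)
      rintro ⟨hcm, hc'⟩
      have h3 : Λ.Consecutive φ ⟨c, hcm⟩ a := by
        refine ⟨?_, v, hv, hc, ha⟩
        rw [← hc'.color_eq, ← SamePath.color_eq h1, hcol]
      exact hik' ((Λ.pathSetoid φ).trans (hc'.tail h3) ((Λ.pathSetoid φ).symm h1))
  have hFterm : ∀ r, ¬ Λ.SamePath φ (Λ.term i) (Λ.term r) →
      F (Λ.term r).val.lowFace = F (Λ.corner (r.val : ZMod (2 * N))) := fun r hr => by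
    have h0 : χ (Λ.term r).val = 0 := by
      rw [hχterm, if_neg]; rwa [← Fin.ext_iff, ← Fin.ext_iff, ← hend]
    have := hFχ _ (Λ.term r).2 h0
    rcases Λ.term_faces r with ⟨h1, h2⟩ | ⟨h1, h2⟩
    · rw [h1]
    · rw [this, h2]
  -- `Q` vanishes on the terminations, so `f` is constant along the boundary and only `g`
  -- distinguishes the corners.
  have hfcorner : ∀ r : ℕ, r < 2 * N →
      f (Λ.corner (r : ZMod (2 * N))) = f (Λ.corner ((0 : ℕ) : ZMod (2 * N))) := fun r => by
    induction r with
    | zero => intro _; rfl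
    | succ r ih =>
      intro hr
      rw [← ih (by omega)]
      have h1 := hf (Λ.term ⟨r, by omega⟩).val
      rw [hQbd _ (Λ.isBoundary_term _)] at h1
      have h2 := eq_of _ _ h1
      rcases Λ.term_faces ⟨r, by omega⟩ with ⟨h3, h4⟩ | ⟨h3, h4⟩ <;> rw [h3, h4] at h2
      · exact h2.symm
      · exact h2
  -- `F` agrees at the two ends of the second path, whereas `g` is 1 at corner `k` and 0 at corner
  -- `l`.
  have h1 := hpath _ hkl
  rw [hFterm k hik', hFterm l hil'] at h1
  simp only [hF] at h1
  rw [hfcorner _ k.2, hfcorner _ l.2, hgc _ k.2.le, hgc _ l.2.le, if_pos ⟨hik, hkj.le⟩,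
    if_neg (by rw [Fin.lt_def] at hjl; omega)] at h1
  exact one_ne_zero (add_left_cancel h1)

/-- Every configuration has a link pattern. -/
theorem exists_represents {m : ℕ} {τ : Fin (2 * N) → Bool} (h : (blackTerms τ).card = 2 * m)
    (hφ : Λ.IsFPLWith τ φ) :
    ∃ π : LinkPattern m, π.Represents (Λ.term ∘ (blackTerms τ).orderEmbOfFin h)
      (Λ.pathSetoid φ) := by
  set emb := (blackTerms τ).orderEmbOfFin h with hemb
  have hblack : ∀ x, φ (Λ.term (emb x)) = true := fun x => by
    rw [hφ.2]
    exact (Finset.mem_filter.1 (Finset.orderEmbOfFin_mem (blackTerms τ) h x)).2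
  have key : ∀ x, ∃ y, y ≠ x ∧ ∀ z, Λ.SamePath φ (Λ.term (emb x)) (Λ.term (emb z)) ↔
      z = x ∨ z = y := by
    intro x
    obtain ⟨l, hl, hend⟩ := exists_other_end hφ.1 (emb x)
    have h1 := ((hend l).2 (Or.inr rfl)).color_eq
    rw [hblack, hφ.2] at h1
    have h2 : l ∈ Set.range emb := by
      rw [hemb, Finset.range_orderEmbOfFin]
      simp [blackTerms, ← h1]
    obtain ⟨y, rfl⟩ := h2
    exact ⟨y, fun h => hl (h ▸ rfl), fun z => by
      rw [hend, emb.injective.eq_iff, emb.injective.eq_iff]⟩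
  choose p hp hend using key
  have hpath : ∀ x, Λ.SamePath φ (Λ.term (emb x)) (Λ.term (emb (p x))) := fun x =>
    (hend x _).2 (Or.inr rfl)
  refine ⟨⟨p, fun x => ?_, hp, fun x y hxy => ?_⟩, fun x y => ?_⟩
  · have h1 := (hend (p x) x).1 ((Λ.pathSetoid φ).symm (hpath x))
    exact (h1.resolve_left (hp x).symm).symm
  · refine not_crossing hφ.1 (emb.strictMono hxy.1) (emb.strictMono hxy.2.1)
      (emb.strictMono hxy.2.2) (hpath x) (hpath y) ?_
    rw [hblack, hblack]
  · constructor
    · rintro rfl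
      exact ⟨(hp x).symm, hpath x⟩
    · rintro ⟨h1, h2⟩
      exact (((hend x y).1 h2).resolve_left h1.symm).symm

end LatticeDomain

/-! ### The generalized gyration -/

namespace LatticeDomain

variable {N : ℕ} {Λ : LatticeDomain N}

/-- The link pattern of a configuration. -/
noncomputable def linkPattern {m : ℕ} {τ : Fin (2 * N) → Bool}
    (h : (blackTerms τ).card = 2 * m) (φ : {φ : Λ.Edge → Bool // Λ.IsFPLWith τ φ}) :
    LinkPattern m :=
  (exists_represents h φ.2).choose

theorem linkPattern_represents {m : ℕ} {τ : Fin (2 * N) → Bool}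
    (h : (blackTerms τ).card = 2 * m) (φ : {φ : Λ.Edge → Bool // Λ.IsFPLWith τ φ}) :
    (linkPattern h φ).Represents (Λ.term ∘ (blackTerms τ).orderEmbOfFin h) (Λ.pathSetoid φ.val) :=
  (exists_represents h φ.2).choose_spec

open Classical in
-- Group the configurations by link pattern; by `Represents.unique`, having the link pattern `π`
-- means that the chosen one equals `π`.
theorem state_eq_sum {m : ℕ} (τ : Fin (2 * N) → Bool) (h : (blackTerms τ).card = 2 * m) :
    Λ.state τ h = ∑ φ : {φ : Λ.Edge → Bool // Λ.IsFPLWith τ φ},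
      Finsupp.single (linkPattern h φ) (1 : ℂ) := by
  have hcount : ∀ π : LinkPattern m, Λ.refinedCount τ h π =
      (Finset.univ.filter fun φ : {φ : Λ.Edge → Bool // Λ.IsFPLWith τ φ} =>
        linkPattern h φ = π).card := fun π => by
    rw [refinedCount, ← Fintype.card_subtype, ← Nat.card_eq_fintype_card]
    refine Nat.card_congr ((Equiv.subtypeSubtypeEquivSubtypeInter _ _).symm.trans
      (Equiv.subtypeEquivRight fun φ => ?_))
    constructor
    · intro h'
      exact (linkPattern_represents h φ).unique (S := Λ.pathSetoid φ.val) h'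
    · rintro rfl
      exact linkPattern_represents h φ
  rw [state, ← Finset.sum_fiberwise (s := Finset.univ) (g := linkPattern h)]
  refine Finset.sum_congr rfl fun π _ => ?_
  rw [Finset.sum_congr rfl fun φ hφ => by rw [(Finset.mem_filter.1 hφ).2], Finset.sum_const,
    hcount π, Nat.cast_smul_eq_nsmul]

open Classical in
theorem exists_closeProd_state {n : ℕ} (τ : Fin (2 * N) → Bool)
    (hn : (mixedPairs τ).card = 2 * n) :
    ∃ ρ : {φ : Λ.Edge → Bool // Λ.IsFPLWith τ φ} → LinkPattern n,
      (∀ φ, (ρ φ).Represents (Λ.term ∘ pairBlack τ ∘ (mixedPairs τ).orderEmbOfFin hn)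
        (Λ.gluedPathSetoid τ φ.val)) ∧
      closeProd n (bbIndices τ) (Λ.state τ (card_blackTerms_eq τ hn)) =
        ∑ φ, Finsupp.single (ρ φ) 1 := by
  choose ρ h1 h2 using fun φ : {φ : Λ.Edge → Bool // Λ.IsFPLWith τ φ} =>
    exists_closeProd_single τ hn (linkPattern_represents (card_blackTerms_eq τ hn) φ)
  refine ⟨ρ, h2, ?_⟩
  rw [state_eq_sum, map_sum]
  exact Finset.sum_congr rfl fun φ _ => h1 φ

/-- The gyration as a bijection between the configurations with complementary boundary
conditions. -/
noncomputable def gyrateEquiv (τ : Fin (2 * N) → Bool) :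
    {φ : Λ.Edge → Bool // Λ.IsFPLWith τ φ} ≃ {φ : Λ.Edge → Bool // Λ.IsFPLWith (complBC τ) φ} where
  toFun φ := ⟨Λ.gyrate φ.val, Λ.isFPLWith_gyrate φ.2⟩
  invFun φ := ⟨Λ.gyrate φ.val, by
    have := Λ.isFPLWith_gyrate φ.2
    rwa [complBC_complBC] at this⟩
  left_inv φ := Subtype.ext (Λ.gyrate_gyrate φ.val)
  right_inv φ := Subtype.ext (Λ.gyrate_gyrate φ.val)

end LatticeDomain

theorem mainTheorem6 {N : ℕ} (Λ : LatticeDomain N) (τ : Fin (2 * N) → Bool)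
    (hvalid : Λ.ValidTriplet τ) (n : ℕ) (hn : (mixedPairs τ).card = 2 * n) :
    closeProd n (bbIndices τ) (Λ.state τ (card_blackTerms_eq τ hn)) =
      closeProd n (bbIndices (complBC τ))
        (Λ.state (complBC τ)
          (card_blackTerms_eq (complBC τ) ((mixedPairs_complBC τ).symm ▸ hn))) := by
  classical
  obtain ⟨ρ, h1, h2⟩ := LatticeDomain.exists_closeProd_state (Λ := Λ) τ hn
  obtain ⟨ρ', h1', h2'⟩ := LatticeDomain.exists_closeProd_state (Λ := Λ) (complBC τ)
    ((mixedPairs_complBC τ).symm ▸ hn)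
  rw [h2, h2']
  refine Fintype.sum_equiv (LatticeDomain.gyrateEquiv τ) _ _ fun φ => ?_
  congr 1
  have h3 := h1' (LatticeDomain.gyrateEquiv τ φ)
  -- Both patterns now refer to the same enumeration of the mixed pairs and can be compared point by
  -- point.
  simp only [mixedPairs_complBC] at h3
  ext1
  funext a
  refine (h1 φ a _).2 ?_
  obtain ⟨h4, h5⟩ := (h3 a _).1 rfl
  exact ⟨h4, (LatticeDomain.gluedPath_gyrate_iff hvalid φ.2
    (Finset.orderEmbOfFin_mem _ hn _) (Finset.orderEmbOfFin_mem _ hn _)).2 h5⟩
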